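/- Let $x=(x^1,x^2)$, $y=(y^1,y^2)$ be coordinates in $\mathbb R^4$ and put $\delta=x^1y^2+x^2y^1$, $\rho=x^1x^2+y^1y^2$, $\sigma=x^1y^2-x^2y^1$. On the open set $\{\delta\neq0\}$ consider the codimension-two 3-web formed by the foliations $x=\mathrm{const}$, $y=\mathrm{const}$, $f(x,y)=\mathrm{const}$, where $$f^1=(x^1+y^1)(x^2-y^2),\qquad f^2=(x^1-y^1)(x^2+y^2).$$ Notation, for a 3-web given in this way by a map $f$ (indices run over $1,2$, repeated indices are summed, $[\,]$ and $(\,)$ denote alternation and symmetrization with weights $1/2!$, $1/3!$): $\omega_1^i=\frac{\partial f^i}{\partial x^j}dx^j$, $\omega_2^i=\frac{\partial f^i}{\partial y^j}dy^j$, with dual frame $E_{1j},E_{2j}$; $\Gamma^i_{jk}=-\partial^2f^i(E_{1j},E_{2k})$; the connection forms are $\omega^i_j=\Gamma^i_{kj}\omega_1^k+\Gamma^i_{jk}\omega_2^k$; the torsion tensor is $a^i_{jk}=\Gamma^i_{[jk]}=a_{[j}\delta^i_{k]}$, which defines the covector $a=(a_1,a_2)$; $p_{ij},q_{ij}$ are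 defined by $da_i-a_j\omega_i^j=p_{ij}\omega_1^j+q_{ij}\omega_2^j$, and $p=p_{[12]}$, $q=q_{[12]}$; the curvature tensor $b^i_{jkl}$ is defined by $d\omega^i_j-\omega^k_j\wedge\omega^i_k=b^i_{jkl}\,\omega_1^k\wedge\omega_2^l$. Where $a\ne0$, the transversal $a$-distribution $\Delta$ is the distribution of 2-planes $a_i\omega_1^i=0$, $a_i\omega_2^i=0$. The integral surfaces of $\Delta$ are geodesically parallel in an affine connection if $\Delta$ is parallel in it, i.e. $\nabla_vX$ lies in $\Delta$ for every vector field $X$ in $\Delta$ and every vector $v$. A planar 3-web is hexagonal if all its sufficiently small hexagonal figures close. A transversal plane at a point is a 2-plane $\xi^2\omega_1^1-\xi^1\omega_1^2=0$, $\xi^2\omega_2^1-\xi^1\omega_2^2=0$ with $\xi\neq0$; the web is transversally geodesic on an open set $U$ if every transversal plane at every point of $U$ is tangent to a surface in $U$ through this point all of whose tangent planes are transversal planes. Then: 1. These equations define a 3-web on $\{\delta\ne0\}$, and on this set $a_1=a_2=-\rho/\delta^2$ and $p=q=\rho\sigma/\delta^4$. In particular $p=q\neq0$ (so the web is nonisoclinic)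 exactly where $\rho\sigma\ne0$. 2. At every point of $\{\delta\neq0\}$ one has $a_1=a_2$ and $\pi_1^1+\pi_1^2-\pi_2^1-\pi_2^2=0$ (where $\pi^i_j$ is the restriction of $\omega^i_j$ to $\omega_1^k=\omega_2^k=0$); $p_{1i}=p_{2i}$ and $q_{1i}=q_{2i}$ for $i=1,2$; $p_{11}-2p_{(12)}+p_{22}=0$ and $q_{11}-2q_{(12)}+q_{22}=0$; and $-b^i_{111}+3(b^i_{(112)}-b^i_{(122)})+b^i_{222}=0$ for $i=1,2$. 3. On $\{\delta\ne0,\ \rho\neq0\}$, where $a\ne0$, the distribution $\Delta$ is given by $\omega_1^1+\omega_1^2=0$, $\omega_2^1+\omega_2^2=0$ and is integrable. Its integral surfaces are geodesically parallel in every affine connection with matrix $\mathrm{diag}(\theta,\theta)$, $\theta^i_j=\omega^i_j+a^i_{jk}(P\omega_1^k+Q\omega_2^k)$, in the frame $(E_{1i},E_{2i})$, where $P,Q$ are arbitrary functions; and the foliations of the web cut a hexagonal planar 3-web on each of these surfaces. 4. At no point of $\{\delta\neq0,\ \rho\neq0,\ \sigma\ne0\}$ is there a $(0,2)$-tensor $b_{kl}$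 with $b^i_{(jkl)}=\delta^i_{(j}b_{kl)}$, and the web is not transversally geodesic on any nonempty open subset of $\{\delta\neq0\}$. -/

import Mathlib

/-!
The sum `f¹ + f² = 2 (x¹x² - y¹y²)` has no mixed second derivatives `∂²/∂xˡ∂yᵐ`, so
`Γ¹ⱼₖ + Γ²ⱼₖ = 0`. This alone gives `ω¹ⱼ + ω²ⱼ = 0`, hence `a₁ = a₂`, `∇aᵢ = daᵢ`, `p₁ᵢ = p₂ᵢ`,
`q₁ᵢ = q₂ᵢ` and `b¹ⱼₖₗ + b²ⱼₖₗ = 0`; moreover `Δ` is the transversal distribution with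
`ξ = (1, -1)`, and the relation `ω¹ + ω² = 0` defining it is preserved by every connection `θ`.

For the example, `Δ` has the first integrals `x¹x²` and `y¹y²`. Since `f¹ - f² = -2σ` and
`δ² = σ² + 4 x¹x² y¹y²`, the functions `x¹y²` and `x²y¹` are locally functions of `f` on an
integral surface. At each point one of them is nonzero, and it turns the web cut on the surface
into the web `x = const`, `y = const`, `xy = const`, which is hexagonal.

A surface tangent to transversal planes only is a product of a curve `X u` and a curve `Y w`.
Differentiating the condition that `∂f/∂u` and `∂f/∂w` be parallel, once in each parameter, makes
`bⁱⱼₖₗ ξʲ ξᵏ ξˡ` proportional to `ξⁱ`. On a transversally geodesic web this holds for all `ξ`, which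
means `bⁱ_(jkl) = δⁱ_(j b_kl)`, and then `b²₁₁₁ = b¹₂₂₂ = 0`. In the example these components are
nonzero multiples of `ρ f²` and `ρ f¹`, which do not both vanish where `ρ σ ≠ 0`.
-/

open scoped ContDiff Topology

noncomputable section

namespace ThreeWeb

/-- The plane `ℝ²`; the index `0` stands for the upper or lower index `1`, and `1` for `2`. -/
abbrev V2 : Type := Fin 2 → ℝ

/-- The ambient space `ℝ⁴`, with points `z = (x, y)`, `x = (x¹, x²)`, `y = (y¹, y²)`. -/
abbrev M4 : Type := V2 × V2

/-- The projection `(v, w) ↦ (v, 0)`. -/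
def projX : M4 →L[ℝ] M4 :=
  (ContinuousLinearMap.inl ℝ V2 V2).comp (ContinuousLinearMap.fst ℝ V2 V2)

/-- The projection `(v, w) ↦ (0, w)`. -/
def projY : M4 →L[ℝ] M4 :=
  (ContinuousLinearMap.inr ℝ V2 V2).comp (ContinuousLinearMap.snd ℝ V2 V2)

/-! ### The web with foliations `x = const`, `y = const`, `f (x, y) = const` -/

/-- The basis forms `ω₁ⁱ = (∂fⁱ/∂xʲ) dxʲ`. -/
def omega1 (f : M4 → V2) (i : Fin 2) (z : M4) : M4 →L[ℝ] ℝ :=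
  (fderiv ℝ (fun w => f w i) z).comp projX

/-- The basis forms `ω₂ⁱ = (∂fⁱ/∂yʲ) dyʲ`. The third family is `ω₃ⁱ = -(ω₁ⁱ + ω₂ⁱ) = -dfⁱ`. -/
def omega2 (f : M4 → V2) (i : Fin 2) (z : M4) : M4 →L[ℝ] ℝ :=
  (fderiv ℝ (fun w => f w i) z).comp projY

/-- The matrix `∂fⁱ/∂xʲ`. -/
def jacX (f : M4 → V2) (z : M4) : Matrix (Fin 2) (Fin 2) ℝ :=
  Matrix.of fun i j => fderiv ℝ (fun w => f w i) z (Pi.single j 1, 0)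

/-- The matrix `∂fⁱ/∂yʲ`. -/
def jacY (f : M4 → V2) (z : M4) : Matrix (Fin 2) (Fin 2) ℝ :=
  Matrix.of fun i j => fderiv ℝ (fun w => f w i) z (0, Pi.single j 1)

/-- The three foliations `x = const`, `y = const`, `f (x, y) = const` form a smooth three-web of
codimension two (pairwise transversal foliations) on the open set `U`. -/
def IsWebOn (f : M4 → V2) (U : Set M4) : Prop :=
  IsOpen U ∧ ContDiffOn ℝ ∞ f U ∧ ∀ z ∈ U, (jacX f z).det ≠ 0 ∧ (jacY f z).det ≠ 0

/-- The vectors `E₁ⱼ` of the frame dual to the coframe `(ω₁ⁱ, ω₂ⁱ)`: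
`ω₁ⁱ(E₁ⱼ) = δⁱⱼ`, `ω₂ⁱ(E₁ⱼ) = 0`. -/
def frame1 (f : M4 → V2) (j : Fin 2) (z : M4) : M4 :=
  (fun l => (jacX f z)⁻¹ l j, 0)

/-- The vectors `E₂ⱼ` of the dual frame: `ω₁ⁱ(E₂ⱼ) = 0`, `ω₂ⁱ(E₂ⱼ) = δⁱⱼ`. -/
def frame2 (f : M4 → V2) (j : Fin 2) (z : M4) : M4 :=
  (0, fun l => (jacY f z)⁻¹ l j)

/-- `Γⁱⱼₖ = -(∂²fⁱ/∂xˡ∂yᵐ) (E₁ⱼ)ˡ (E₂ₖ)ᵐ`. -/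
def Gam (f : M4 → V2) (i j k : Fin 2) (z : M4) : ℝ :=
  -(fderiv ℝ (fderiv ℝ (fun w => f w i)) z (frame1 f j z) (frame2 f k z))

/-- The connection forms of the web, `conn f i j = ωⱼⁱ = Γⁱₖⱼ ω₁ᵏ + Γⁱⱼₖ ω₂ᵏ`. -/
def conn (f : M4 → V2) (i j : Fin 2) (z : M4) : M4 →L[ℝ] ℝ :=
  ∑ k, (Gam f i k j z • omega1 f k z + Gam f i j k z • omega2 f k z)

/-- The torsion tensor `aⁱⱼₖ = Γⁱ_[jk]`. -/
def torsion (f : M4 → V2) (i j k : Fin 2) (z : M4) : ℝ :=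
  (Gam f i j k z - Gam f i k j z) / 2

/-- The covector `a` of the web. It is determined by
`aⁱⱼₖ = a_[j δⁱ_k] = (aⱼ δⁱₖ - aₖ δⁱⱼ) / 2`, whose trace over `i = k` is `aⁱⱼᵢ = aⱼ / 2`. -/
def covec (f : M4 → V2) (j : Fin 2) (z : M4) : ℝ :=
  2 * ∑ i, torsion f i j i z

/-- The covariant differential `∇aᵢ = daᵢ - aₖ ωᵢᵏ = pᵢⱼ ω₁ʲ + qᵢⱼ ω₂ʲ`. -/
def nablaCovec (f : M4 → V2) (i : Fin 2) (z : M4) : M4 →L[ℝ] ℝ :=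
  fderiv ℝ (covec f i) z - ∑ k, covec f k z • conn f k i z

/-- The Pfaffian derivatives `pᵢⱼ`. -/
def pT (f : M4 → V2) (i j : Fin 2) (z : M4) : ℝ := nablaCovec f i z (frame1 f j z)

/-- The Pfaffian derivatives `qᵢⱼ`. -/
def qT (f : M4 → V2) (i j : Fin 2) (z : M4) : ℝ := nablaCovec f i z (frame2 f j z)

/-- `p = p_[12]`. -/
def pInv (f : M4 → V2) (z : M4) : ℝ := (pT f 0 1 z - pT f 1 0 z) / 2

/-- `q = q_[12]`. -/
def qInv (f : M4 → V2) (z : M4) : ℝ := (qT f 0 1 z - qT f 1 0 z) / 2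

/-- The exterior derivative of a one-form on `ℝ⁴`. -/
def dForm (α : M4 → M4 →L[ℝ] ℝ) (z X Y : M4) : ℝ :=
  fderiv ℝ α z X Y - fderiv ℝ α z Y X

/-- The curvature two-forms `dωⱼⁱ - ωⱼᵏ ∧ ωₖⁱ = bⁱⱼₖₗ ω₁ᵏ ∧ ω₂ˡ`. -/
def curvForm (f : M4 → V2) (i j : Fin 2) (z X Y : M4) : ℝ :=
  dForm (conn f i j) z X Y
    - ∑ k, (conn f k j z X * conn f i k z Y - conn f k j z Y * conn f i k z X)

/-- The curvature tensor `bⁱⱼₖₗ`. -/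
def curv (f : M4 → V2) (i j k l : Fin 2) (z : M4) : ℝ :=
  curvForm f i j z (frame1 f k z) (frame2 f l z)

/-- Symmetrization `T_(jkl)` over three lower indices. -/
def sym3 (T : Fin 2 → Fin 2 → Fin 2 → ℝ) (j k l : Fin 2) : ℝ :=
  (T j k l + T j l k + T k j l + T k l j + T l j k + T l k j) / 6

/-- The symmetrized curvature tensor `bⁱ_(jkl)`. -/
def curvSym (f : M4 → V2) (i j k l : Fin 2) (z : M4) : ℝ :=
  sym3 (fun j k l => curv f i j k l z) j k l

/-- `bⁱ_(jkl) = δⁱ_(j b_kl)` at `z` for some `b_kl`. -/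
def CurvSymIsTrace (f : M4 → V2) (z : M4) : Prop :=
  ∃ c : Fin 2 → Fin 2 → ℝ, ∀ i j k l : Fin 2,
    curvSym f i j k l z = sym3 (fun j k l => if i = j then c k l else 0) j k l

/-! ### Surfaces and the transversal distributions -/

/-- A smooth parametrized (immersed) surface in `ℝ⁴` over the open set `O` of `ℝ²`. -/
def IsSurface (O : Set (ℝ × ℝ)) (φ : ℝ × ℝ → M4) : Prop :=
  IsOpen O ∧ ContDiffOn ℝ ∞ φ O ∧ ∀ s ∈ O, Function.Injective (fderiv ℝ φ s)

/-- The tangent plane of a parametrized surface at the parameter `s`. -/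
def tangentPlane (φ : ℝ × ℝ → M4) (s : ℝ × ℝ) : Submodule ℝ M4 :=
  LinearMap.range (fderiv ℝ φ s).toLinearMap

/-- The surface `φ` over `O` is an integral surface of the distribution `D`. -/
def IsIntegralSurface (D : M4 → Submodule ℝ M4) (O : Set (ℝ × ℝ)) (φ : ℝ × ℝ → M4) : Prop :=
  IsSurface O φ ∧ ∀ s ∈ O, tangentPlane φ s = D (φ s)

/-- The distribution `D` of planes is integrable on `U`: through every point of `U` there passes
an integral surface. -/
def IsIntegrableOn (D : M4 → Submodule ℝ M4) (U : Set M4) : Prop :=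
  ∀ z ∈ U, ∃ (O : Set (ℝ × ℝ)) (φ : ℝ × ℝ → M4), 0 ∈ O ∧ φ 0 = z ∧
    Set.MapsTo φ O U ∧ IsIntegralSurface D O φ

/-- The transversal `a`-distribution `Δ`: `a₁ω₁¹ + a₂ω₁² = 0`, `a₁ω₂¹ + a₂ω₂² = 0`. -/
def aDist (f : M4 → V2) (z : M4) : Submodule ℝ M4 :=
  LinearMap.ker (∑ i, covec f i z • omega1 f i z).toLinearMap ⊓
    LinearMap.ker (∑ i, covec f i z • omega2 f i z).toLinearMap

/-- The transversal plane given by the direction `ξ ≠ 0`: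
`ξ²ω₁¹ - ξ¹ω₁² = 0`, `ξ²ω₂¹ - ξ¹ω₂² = 0`. -/
def transPlane (f : M4 → V2) (z : M4) (ξ : V2) : Submodule ℝ M4 :=
  LinearMap.ker (ξ 1 • omega1 f 0 z - ξ 0 • omega1 f 1 z).toLinearMap ⊓
    LinearMap.ker (ξ 1 • omega2 f 0 z - ξ 0 • omega2 f 1 z).toLinearMap

/-- The web is transversally geodesic on `U`: every transversal plane at every point of `U` is
tangent there to a surface of `U` all of whose tangent planes are transversal planes. (Such a
surface is automatically totally geodesic for the connection of the web.) -/
def IsTransversallyGeodesicOn (f : M4 → V2) (U : Set M4) : Prop :=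
  ∀ z ∈ U, ∀ ξ : V2, ξ ≠ 0 → ∃ (O : Set (ℝ × ℝ)) (φ : ℝ × ℝ → M4),
    0 ∈ O ∧ φ 0 = z ∧ Set.MapsTo φ O U ∧ IsSurface O φ ∧
    tangentPlane φ 0 = transPlane f z ξ ∧
    ∀ s ∈ O, ∃ η : V2, η ≠ 0 ∧ tangentPlane φ s = transPlane f (φ s) η

/-! ### Geodesic parallelism -/

/-- The forms `θⱼⁱ = ωⱼⁱ + aⁱⱼₖ (P ω₁ᵏ + Q ω₂ᵏ)` of a connection of the bundle of affine
connections of the web; `P` and `Q` are arbitrary functions. -/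
def theta (f : M4 → V2) (P Q : M4 → ℝ) (i j : Fin 2) (z : M4) : M4 →L[ℝ] ℝ :=
  conn f i j z + ∑ k, torsion f i j k z • (P z • omega1 f k z + Q z • omega2 f k z)

/-- The covariant derivative `∇_v X` at `z` in the affine connection whose matrix in the frame
`(E₁₁, E₁₂, E₂₁, E₂₂)` is `diag (θ, θ)`. -/
def covDeriv (f : M4 → V2) (P Q : M4 → ℝ) (X : M4 → M4) (z v : M4) : M4 :=
  ∑ i, ((fderiv ℝ (fun w => omega1 f i w (X w)) z v
          + ∑ j, theta f P Q i j z v * omega1 f j z (X z)) • frame1 f i z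
      + (fderiv ℝ (fun w => omega2 f i w (X w)) z v
          + ∑ j, theta f P Q i j z v * omega2 f j z (X z)) • frame2 f i z)

/-- The integral surfaces of `D` in `U` are geodesically parallel in the connection `θ`: the
distribution of their tangent planes is parallel, that is, for every vector field `X` tangent to
them and every vector `v` (tangent to them or not), `∇_v X` is tangent to them. -/
def IsGeodesicallyParallelOn (f : M4 → V2) (P Q : M4 → ℝ) (D : M4 → Submodule ℝ M4)
    (U : Set M4) : Prop :=
  ∀ z ∈ U, ∀ X : M4 → M4, DifferentiableAt ℝ X z → (∀ᶠ w in 𝓝 z, X w ∈ D w) →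
    ∀ v : M4, covDeriv f P Q X z v ∈ D z

/-! ### Hexagonal two-dimensional webs -/

/-- Every hexagonal figure of the families of level sets of `h₁`, `h₂`, `h₃` inside `N` closes:
`P₀` is the centre; the diagonals `P₁P₄`, `P₂P₅`, `P₃P₆` lie on the leaves of the families
1, 2, 3 through `P₀`; the sides `P₁P₂`, `P₂P₃`, `P₃P₄`, `P₄P₅`, `P₅P₆` lie on leaves of the
families 3, 1, 2, 3, 1. Then `P₆P₁` lies on a leaf of the family 2. -/
def HexagonsClose (h₁ h₂ h₃ : ℝ × ℝ → V2) (N : Set (ℝ × ℝ)) : Prop :=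
  ∀ P₀ ∈ N, ∀ P₁ ∈ N, ∀ P₂ ∈ N, ∀ P₃ ∈ N, ∀ P₄ ∈ N, ∀ P₅ ∈ N, ∀ P₆ ∈ N,
    h₁ P₁ = h₁ P₀ → h₁ P₄ = h₁ P₀ →
    h₂ P₂ = h₂ P₀ → h₂ P₅ = h₂ P₀ →
    h₃ P₃ = h₃ P₀ → h₃ P₆ = h₃ P₀ →
    h₃ P₁ = h₃ P₂ → h₁ P₂ = h₁ P₃ → h₂ P₃ = h₂ P₄ → h₃ P₄ = h₃ P₅ → h₁ P₅ = h₁ P₆ →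
    h₂ P₆ = h₂ P₁

/-- The level sets of `h₁`, `h₂`, `h₃` form a two-dimensional three-web on `O`: at each point the
three tangent directions are lines, pairwise distinct. -/
def IsPlanarWeb (h₁ h₂ h₃ : ℝ × ℝ → V2) (O : Set (ℝ × ℝ)) : Prop :=
  ContDiffOn ℝ ∞ h₁ O ∧ ContDiffOn ℝ ∞ h₂ O ∧ ContDiffOn ℝ ∞ h₃ O ∧ ∀ s ∈ O,
    Module.finrank ℝ (LinearMap.ker (fderiv ℝ h₁ s).toLinearMap) = 1 ∧
    Module.finrank ℝ (LinearMap.ker (fderiv ℝ h₂ s).toLinearMap) = 1 ∧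
    Module.finrank ℝ (LinearMap.ker (fderiv ℝ h₃ s).toLinearMap) = 1 ∧
    LinearMap.ker (fderiv ℝ h₁ s).toLinearMap ⊓ LinearMap.ker (fderiv ℝ h₂ s).toLinearMap = ⊥ ∧
    LinearMap.ker (fderiv ℝ h₁ s).toLinearMap ⊓ LinearMap.ker (fderiv ℝ h₃ s).toLinearMap = ⊥ ∧
    LinearMap.ker (fderiv ℝ h₂ s).toLinearMap ⊓ LinearMap.ker (fderiv ℝ h₃ s).toLinearMap = ⊥

/-- The foliations of the web cut on the surface `φ` over `O` a two-dimensional three-web which is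
hexagonal: all sufficiently small hexagonal figures close. -/
def CutsHexagonalWeb (f : M4 → V2) (O : Set (ℝ × ℝ)) (φ : ℝ × ℝ → M4) : Prop :=
  IsPlanarWeb (fun s => (φ s).1) (fun s => (φ s).2) (fun s => f (φ s)) O ∧
    ∀ s ∈ O, ∃ N ∈ 𝓝 s, N ⊆ O ∧
      HexagonsClose (fun t => (φ t).1) (fun t => (φ t).2) (fun t => f (φ t)) N

/-! ### Pointwise conditions on the tensors of a web -/

/-- `a₁ = a₂` and `π₁¹ + π₁² - π₂¹ - π₂² = 0`, where `πⱼⁱ` is the restriction of `ωⱼⁱ` to the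
common kernel of the forms `ω₁ᵏ`, `ω₂ᵏ`. -/
def EqualCovecCond (f : M4 → V2) (z : M4) : Prop :=
  covec f 0 z = covec f 1 z ∧
    ∀ v : M4, (∀ k, omega1 f k z v = 0 ∧ omega2 f k z v = 0) →
      conn f 0 0 z v + conn f 1 0 z v - conn f 0 1 z v - conn f 1 1 z v = 0

/-- `p₁₁ - 2p_(12) + p₂₂ = 0`, `q₁₁ - 2q_(12) + q₂₂ = 0`. -/
def IntegrabilityCond (f : M4 → V2) (z : M4) : Prop :=
  pT f 0 0 z - (pT f 0 1 z + pT f 1 0 z) + pT f 1 1 z = 0 ∧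
    qT f 0 0 z - (qT f 0 1 z + qT f 1 0 z) + qT f 1 1 z = 0

/-- `p₁ᵢ = p₂ᵢ`, `q₁ᵢ = q₂ᵢ`. -/
def ParallelCond (f : M4 → V2) (z : M4) : Prop :=
  ∀ i, pT f 0 i z = pT f 1 i z ∧ qT f 0 i z = qT f 1 i z

/-- `-bⁱ₁₁₁ + 3(bⁱ_(112) - bⁱ_(122)) + bⁱ₂₂₂ = 0`, `i = 1, 2`. -/
def HexagonalCond (f : M4 → V2) (z : M4) : Prop :=
  ∀ i, -curv f i 0 0 0 z + 3 * (curvSym f i 0 0 1 z - curvSym f i 0 1 1 z)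
    + curv f i 1 1 1 z = 0

/-! ### The web of the example -/

/-- `u₃¹ = (x¹ + y¹)(x² - y²)`, `u₃² = (x¹ - y¹)(x² + y²)`. -/
def exWeb (z : M4) : V2 :=
  ![(z.1 0 + z.2 0) * (z.1 1 - z.2 1), (z.1 0 - z.2 0) * (z.1 1 + z.2 1)]

/-- `x¹y² + x²y¹`. -/
def dlt (z : M4) : ℝ := z.1 0 * z.2 1 + z.1 1 * z.2 0

/-- `ρ = x¹x² + y¹y²`. -/
def rho (z : M4) : ℝ := z.1 0 * z.1 1 + z.2 0 * z.2 1

/-- `σ = x¹y² - x²y¹`. -/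
def sigm (z : M4) : ℝ := z.1 0 * z.2 1 - z.1 1 * z.2 0

/-- The domain of the web. -/
def dom : Set M4 := {z | dlt z ≠ 0}

/-- The part of the domain where the covector `a` does not vanish, so that `Δ` is defined. -/
def domA : Set M4 := {z | dlt z ≠ 0 ∧ rho z ≠ 0}

/-- The part of the domain where the web is nonisoclinic. -/
def domN : Set M4 := {z | dlt z ≠ 0 ∧ rho z ≠ 0 ∧ sigm z ≠ 0}

end ThreeWeb

end

open ThreeWeb

namespace ThreeWeb

section

variable {f : M4 → V2} {U : Set M4} {z : M4}

/-- The second derivative of the component `fⁱ`, as a bilinear form on `ℝ⁴`. -/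
noncomputable def hess (f : M4 → V2) (i : Fin 2) (z : M4) : M4 →L[ℝ] M4 →L[ℝ] ℝ :=
  fderiv ℝ (fderiv ℝ fun w => f w i) z

/-- The vector of the first factor with `ω₁ⁱ = ξⁱ`, so that `frameX f z ξ = ξⁱ E₁ᵢ`. -/
noncomputable def frameX (f : M4 → V2) (z : M4) (ξ : V2) : M4 := ((jacX f z)⁻¹.mulVec ξ, 0)

/-- The vector of the second factor with `ω₂ⁱ = ξⁱ`, so that `frameY f z ξ = ξⁱ E₂ᵢ`. -/
noncomputable def frameY (f : M4 → V2) (z : M4) (ξ : V2) : M4 := (0, (jacY f z)⁻¹.mulVec ξ)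

lemma projX_apply (v : M4) : projX v = (v.1, 0) := rfl

lemma projY_apply (v : M4) : projY v = (0, v.2) := rfl

lemma omega1_apply (f : M4 → V2) (i : Fin 2) (z v : M4) :
    omega1 f i z v = fderiv ℝ (fun w => f w i) z (v.1, 0) := rfl

lemma omega2_apply (f : M4 → V2) (i : Fin 2) (z v : M4) :
    omega2 f i z v = fderiv ℝ (fun w => f w i) z (0, v.2) := rfl

lemma omega1_add_omega2 (f : M4 → V2) (i : Fin 2) (z v : M4) :
    omega1 f i z v + omega2 f i z v = fderiv ℝ (fun w => f w i) z v := by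
  simp only [omega1_apply, omega2_apply, ← map_add, Prod.mk_add_mk, add_zero, zero_add, Prod.mk.eta]

lemma omega1_eq_mulVec (f : M4 → V2) (i : Fin 2) (z v : M4) :
    omega1 f i z v = (jacX f z).mulVec v.1 i := by
  have hv : (v.1, (0 : V2)) = v.1 0 • (Pi.single 0 1, 0) + v.1 1 • (Pi.single 1 1, 0) := by
    ext i <;> fin_cases i <;> simp
  rw [omega1_apply, hv]
  simp only [map_add, map_smul, smul_eq_mul, Matrix.mulVec, dotProduct, Fin.sum_univ_two, jacX,
    Matrix.of_apply, mul_comm]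

lemma omega2_eq_mulVec (f : M4 → V2) (i : Fin 2) (z v : M4) :
    omega2 f i z v = (jacY f z).mulVec v.2 i := by
  have hv : ((0 : V2), v.2) = v.2 0 • (0, Pi.single 0 1) + v.2 1 • (0, Pi.single 1 1) := by
    ext i <;> fin_cases i <;> simp
  rw [omega2_apply, hv]
  simp only [map_add, map_smul, smul_eq_mul, Matrix.mulVec, dotProduct, Fin.sum_univ_two, jacY,
    Matrix.of_apply, mul_comm]

lemma frameX_eq (f : M4 → V2) (z : M4) (ξ : V2) :
    frameX f z ξ = ∑ j, ξ j • frame1 f j z := by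
  ext i <;> fin_cases i <;> simp [frameX, frame1, mul_comm]

lemma frameY_eq (f : M4 → V2) (z : M4) (ξ : V2) :
    frameY f z ξ = ∑ j, ξ j • frame2 f j z := by
  ext i <;> fin_cases i <;> simp [frameY, frame2, mul_comm]

lemma omega1_frameX (hz : (jacX f z).det ≠ 0) (i : Fin 2) (ξ : V2) :
    omega1 f i z (frameX f z ξ) = ξ i := by
  rw [omega1_eq_mulVec, frameX, Matrix.mulVec_mulVec, Matrix.mul_nonsing_inv _ hz.isUnit,
    Matrix.one_mulVec]

lemma omega2_frameY (hz : (jacY f z).det ≠ 0) (i : Fin 2) (ξ : V2) :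
    omega2 f i z (frameY f z ξ) = ξ i := by
  rw [omega2_eq_mulVec, frameY, Matrix.mulVec_mulVec, Matrix.mul_nonsing_inv _ hz.isUnit,
    Matrix.one_mulVec]

lemma frameX_omega1 (hz : (jacX f z).det ≠ 0) (v : M4) :
    frameX f z (fun i => omega1 f i z v) = projX v := by
  simp only [omega1_eq_mulVec, frameX, projX_apply, Matrix.mulVec_mulVec,
    Matrix.nonsing_inv_mul _ hz.isUnit, Matrix.one_mulVec]

lemma frameY_omega2 (hz : (jacY f z).det ≠ 0) (v : M4) :
    frameY f z (fun i => omega2 f i z v) = projY v := by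
  simp only [omega2_eq_mulVec, frameY, projY_apply, Matrix.mulVec_mulVec,
    Matrix.nonsing_inv_mul _ hz.isUnit, Matrix.one_mulVec]

lemma projX_add_projY (v : M4) : projX v + projY v = v := by simp [projX_apply, projY_apply]

lemma frame1_eq_frameX (f : M4 → V2) (j : Fin 2) (z : M4) :
    frame1 f j z = frameX f z (Pi.single j 1) := by
  simp [frameX_eq, Pi.single_apply]

lemma frame2_eq_frameY (f : M4 → V2) (j : Fin 2) (z : M4) :
    frame2 f j z = frameY f z (Pi.single j 1) := by
  simp [frameY_eq, Pi.single_apply]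

lemma omega1_frameY (f : M4 → V2) (i : Fin 2) (z : M4) (ξ : V2) :
    omega1 f i z (frameY f z ξ) = 0 := map_zero (fderiv ℝ (fun w => f w i) z)

lemma omega2_frameX (f : M4 → V2) (i : Fin 2) (z : M4) (ξ : V2) :
    omega2 f i z (frameX f z ξ) = 0 := map_zero (fderiv ℝ (fun w => f w i) z)

@[simp] lemma omega1_frame2 (f : M4 → V2) (i j : Fin 2) (z : M4) :
    omega1 f i z (frame2 f j z) = 0 := map_zero (fderiv ℝ (fun w => f w i) z)

@[simp] lemma omega2_frame1 (f : M4 → V2) (i j : Fin 2) (z : M4) :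
    omega2 f i z (frame1 f j z) = 0 := map_zero (fderiv ℝ (fun w => f w i) z)

lemma projX_frame1 (f : M4 → V2) (j : Fin 2) (z : M4) : projX (frame1 f j z) = frame1 f j z := rfl

lemma projY_frame1 (f : M4 → V2) (j : Fin 2) (z : M4) : projY (frame1 f j z) = 0 := rfl

lemma projX_frame2 (f : M4 → V2) (j : Fin 2) (z : M4) : projX (frame2 f j z) = 0 := rfl

lemma projY_frame2 (f : M4 → V2) (j : Fin 2) (z : M4) : projY (frame2 f j z) = frame2 f j z := rfl

lemma omega1_frame1 (hz : (jacX f z).det ≠ 0) (i j : Fin 2) :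
    omega1 f i z (frame1 f j z) = if i = j then 1 else 0 := by
  rw [frame1_eq_frameX, omega1_frameX hz, Pi.single_apply]

lemma omega2_frame2 (hz : (jacY f z).det ≠ 0) (i j : Fin 2) :
    omega2 f i z (frame2 f j z) = if i = j then 1 else 0 := by
  rw [frame2_eq_frameY, omega2_frameY hz, Pi.single_apply]

lemma conn_frame1 (hz : (jacX f z).det ≠ 0) (i j k : Fin 2) :
    conn f i j z (frame1 f k z) = Gam f i k j z := by
  fin_cases k <;> simp [conn, omega1_frame1 hz]

lemma conn_frame2 (hz : (jacY f z).det ≠ 0) (i j k : Fin 2) :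
    conn f i j z (frame2 f k z) = Gam f i j k z := by
  fin_cases k <;> simp [conn, omega2_frame2 hz]

lemma Gam_eq (f : M4 → V2) (i j k : Fin 2) (z : M4) :
    Gam f i j k z = -hess f i z (frame1 f j z) (frame2 f k z) := rfl

lemma conn_apply (hX : (jacX f z).det ≠ 0) (hY : (jacY f z).det ≠ 0) (i j : Fin 2) (v : M4) :
    conn f i j z v =
      -hess f i z (projX v) (frame2 f j z) - hess f i z (frame1 f j z) (projY v) := by
  rw [← frameX_omega1 hX, ← frameY_omega2 hY, frameX_eq, frameY_eq]
  simp [conn, Gam_eq]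
  ring

lemma IsWebOn.mono {V : Set M4} (hf : IsWebOn f U) (hV : IsOpen V) (hVU : V ⊆ U) : IsWebOn f V :=
  ⟨hV, hf.2.1.mono hVU, fun z hz => hf.2.2 z (hVU hz)⟩

lemma IsWebOn.mem_nhds (hf : IsWebOn f U) (hz : z ∈ U) : U ∈ 𝓝 z := hf.1.mem_nhds hz

lemma IsWebOn.det_jacX_ne_zero (hf : IsWebOn f U) (hz : z ∈ U) : (jacX f z).det ≠ 0 :=
  (hf.2.2 z hz).1

lemma IsWebOn.det_jacY_ne_zero (hf : IsWebOn f U) (hz : z ∈ U) : (jacY f z).det ≠ 0 :=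
  (hf.2.2 z hz).2

lemma IsWebOn.contDiffAt (hf : IsWebOn f U) (hz : z ∈ U) (i : Fin 2) :
    ContDiffAt ℝ ∞ (fun w => f w i) z :=
  contDiffAt_pi.1 (hf.2.1.contDiffAt (hf.mem_nhds hz)) i

lemma IsWebOn.contDiffAt_fderiv (hf : IsWebOn f U) (hz : z ∈ U) (i : Fin 2) :
    ContDiffAt ℝ ∞ (fderiv ℝ fun w => f w i) z :=
  (hf.contDiffAt hz i).fderiv_right le_rfl

lemma IsWebOn.contDiffAt_hess (hf : IsWebOn f U) (hz : z ∈ U) (i : Fin 2) :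
    ContDiffAt ℝ ∞ (hess f i) z :=
  (hf.contDiffAt_fderiv hz i).fderiv_right le_rfl

lemma IsWebOn.hasFDerivAt_fderiv (hf : IsWebOn f U) (hz : z ∈ U) (i : Fin 2) :
    HasFDerivAt (fderiv ℝ fun w => f w i) (hess f i z) z :=
  ((hf.contDiffAt_fderiv hz i).differentiableAt (by simp)).hasFDerivAt

lemma IsWebOn.hasFDerivAt_hess (hf : IsWebOn f U) (hz : z ∈ U) (i : Fin 2) :
    HasFDerivAt (hess f i) (fderiv ℝ (hess f i) z) z :=
  ((hf.contDiffAt_hess hz i).differentiableAt (by simp)).hasFDerivAt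

lemma IsWebOn.hess_comm (hf : IsWebOn f U) (hz : z ∈ U) (i : Fin 2) (v w : M4) :
    hess f i z v w = hess f i z w v :=
  ((hf.contDiffAt hz i).isSymmSndFDerivAt (by simp [ENat.LEInfty.out])).eq v w

lemma IsWebOn.fderiv_hess_comm (hf : IsWebOn f U) (hz : z ∈ U) (i : Fin 2) (v w : M4) :
    fderiv ℝ (hess f i) z v w = fderiv ℝ (hess f i) z w v :=
  ((hf.contDiffAt_fderiv hz i).isSymmSndFDerivAt (by simp [ENat.LEInfty.out])).eq v w

lemma differentiableAt_matrix_det {E n : Type*} [NormedAddCommGroup E] [NormedSpace ℝ E]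
    [Fintype n] [DecidableEq n] {A : E → Matrix n n ℝ} {x : E}
    (hA : ∀ i j, DifferentiableAt ℝ (fun y => A y i j) x) :
    DifferentiableAt ℝ (fun y => (A y).det) x := by
  simp only [Matrix.det_apply']
  fun_prop

lemma differentiableAt_matrix_inv {E n : Type*} [NormedAddCommGroup E] [NormedSpace ℝ E]
    [Fintype n] [DecidableEq n] {A : E → Matrix n n ℝ} {x : E}
    (hA : ∀ i j, DifferentiableAt ℝ (fun y => A y i j) x) (hx : (A x).det ≠ 0) (i j : n) :
    DifferentiableAt ℝ (fun y => (A y)⁻¹ i j) x := by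
  simp only [Matrix.inv_def, Ring.inverse_eq_inv', Matrix.smul_apply, Matrix.adjugate_apply]
  refine ((differentiableAt_matrix_det hA).inv hx).smul (differentiableAt_matrix_det fun k l => ?_)
  by_cases hk : k = j
  · subst hk
    simpa only [Matrix.updateRow_self] using differentiableAt_const _
  · simpa only [Matrix.updateRow_ne hk] using hA k l

lemma IsWebOn.differentiableAt_frame1 (hf : IsWebOn f U) (hz : z ∈ U) (j : Fin 2) :
    DifferentiableAt ℝ (frame1 f j) z := by
  refine (differentiableAt_pi.2 fun l => ?_).prodMk (differentiableAt_const _)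
  exact differentiableAt_matrix_inv
    (fun i j => (hf.hasFDerivAt_fderiv hz i).differentiableAt.clm_apply (differentiableAt_const _))
    (hf.det_jacX_ne_zero hz) l j

lemma IsWebOn.differentiableAt_frame2 (hf : IsWebOn f U) (hz : z ∈ U) (j : Fin 2) :
    DifferentiableAt ℝ (frame2 f j) z := by
  refine (differentiableAt_const _).prodMk (differentiableAt_pi.2 fun l => ?_)
  exact differentiableAt_matrix_inv
    (fun i j => (hf.hasFDerivAt_fderiv hz i).differentiableAt.clm_apply (differentiableAt_const _))
    (hf.det_jacY_ne_zero hz) l j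

lemma IsWebOn.fderiv_apply_fderiv_of_eventuallyEq (hf : IsWebOn f U) (hz : z ∈ U) (i : Fin 2)
    {E : M4 → M4} (hE : DifferentiableAt ℝ E z) {c : ℝ}
    (hc : ∀ᶠ w in 𝓝 z, fderiv ℝ (fun w => f w i) w (E w) = c) (v : M4) :
    fderiv ℝ (fun w => f w i) z (fderiv ℝ E z v) = -hess f i z v (E z) := by
  have hd := congrArg (· v) <| ((hf.hasFDerivAt_fderiv hz i).clm_apply hE.hasFDerivAt).unique
    ((hasFDerivAt_const c z).congr_of_eventuallyEq hc)
  simp only [add_apply, ContinuousLinearMap.comp_apply, ContinuousLinearMap.flip_apply,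
    zero_apply] at hd
  exact eq_neg_of_add_eq_zero_left hd

lemma IsWebOn.fderiv_frame1 (hf : IsWebOn f U) (hz : z ∈ U) (j : Fin 2) (v : M4) :
    fderiv ℝ (frame1 f j) z v = -∑ m, hess f m z v (frame1 f j z) • frame1 f m z := by
  have hE := hf.differentiableAt_frame1 hz j
  have hproj : projX (fderiv ℝ (frame1 f j) z v) = fderiv ℝ (frame1 f j) z v :=
    congrArg (· v) ((projX.hasFDerivAt.comp z hE.hasFDerivAt).unique hE.hasFDerivAt)
  have homega (m : Fin 2) :
      omega1 f m z (fderiv ℝ (frame1 f j) z v) = -hess f m z v (frame1 f j z) := by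
    rw [omega1, ContinuousLinearMap.comp_apply, hproj]
    refine hf.fderiv_apply_fderiv_of_eventuallyEq hz m hE (c := if m = j then 1 else 0) ?_ v
    filter_upwards [hf.mem_nhds hz] with w hw
    exact omega1_frame1 (hf.det_jacX_ne_zero hw) m j
  rw [← hproj, ← frameX_omega1 (hf.det_jacX_ne_zero hz), frameX_eq]
  simp only [homega, neg_smul, Finset.sum_neg_distrib]

lemma IsWebOn.fderiv_frame2 (hf : IsWebOn f U) (hz : z ∈ U) (j : Fin 2) (v : M4) :
    fderiv ℝ (frame2 f j) z v = -∑ m, hess f m z v (frame2 f j z) • frame2 f m z := by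
  have hE := hf.differentiableAt_frame2 hz j
  have hproj : projY (fderiv ℝ (frame2 f j) z v) = fderiv ℝ (frame2 f j) z v :=
    congrArg (· v) ((projY.hasFDerivAt.comp z hE.hasFDerivAt).unique hE.hasFDerivAt)
  have homega (m : Fin 2) :
      omega2 f m z (fderiv ℝ (frame2 f j) z v) = -hess f m z v (frame2 f j z) := by
    rw [omega2, ContinuousLinearMap.comp_apply, hproj]
    refine hf.fderiv_apply_fderiv_of_eventuallyEq hz m hE (c := if m = j then 1 else 0) ?_ v
    filter_upwards [hf.mem_nhds hz] with w hw
    exact omega2_frame2 (hf.det_jacY_ne_zero hw) m j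
  rw [← hproj, ← frameY_omega2 (hf.det_jacY_ne_zero hz), frameY_eq]
  simp only [homega, neg_smul, Finset.sum_neg_distrib]

lemma IsWebOn.differentiableAt_Gam (hf : IsWebOn f U) (hz : z ∈ U) (i j k : Fin 2) :
    DifferentiableAt ℝ (Gam f i j k) z :=
  (((hf.hasFDerivAt_hess hz i).differentiableAt.clm_apply
    (hf.differentiableAt_frame1 hz j)).clm_apply (hf.differentiableAt_frame2 hz k)).neg

lemma IsWebOn.differentiableAt_omega1 (hf : IsWebOn f U) (hz : z ∈ U) (i : Fin 2) :
    DifferentiableAt ℝ (omega1 f i) z :=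
  (hf.hasFDerivAt_fderiv hz i).differentiableAt.clm_comp (differentiableAt_const _)

lemma IsWebOn.differentiableAt_omega2 (hf : IsWebOn f U) (hz : z ∈ U) (i : Fin 2) :
    DifferentiableAt ℝ (omega2 f i) z :=
  (hf.hasFDerivAt_fderiv hz i).differentiableAt.clm_comp (differentiableAt_const _)

lemma IsWebOn.differentiableAt_conn (hf : IsWebOn f U) (hz : z ∈ U) (i j : Fin 2) :
    DifferentiableAt ℝ (conn f i j) z :=
  DifferentiableAt.fun_sum fun k _ =>
    ((hf.differentiableAt_Gam hz i k j).smul (hf.differentiableAt_omega1 hz k)).add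
      ((hf.differentiableAt_Gam hz i j k).smul (hf.differentiableAt_omega2 hz k))

lemma IsWebOn.fderiv_conn_frame1 (hf : IsWebOn f U) (hz : z ∈ U) (i j k : Fin 2) (v : M4) :
    fderiv ℝ (conn f i j) z v (frame1 f k z) =
      -fderiv ℝ (hess f i) z v (frame1 f k z) (frame2 f j z)
        + ∑ m, hess f m z v (frame2 f j z) * hess f i z (frame1 f k z) (frame2 f m z) := by
  have hconn : (fun w => conn f i j w (frame1 f k z)) =ᶠ[𝓝 z]
      fun w => -hess f i w (frame1 f k z) (frame2 f j w) := by
    filter_upwards [hf.mem_nhds hz] with w hw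
    simp only [conn_apply (hf.det_jacX_ne_zero hw) (hf.det_jacY_ne_zero hw), projX_frame1,
      projY_frame1, map_zero, sub_zero]
  have hd := congrArg (· v) <|
    ((hf.differentiableAt_conn hz i j).hasFDerivAt.clm_apply (hasFDerivAt_const _ z)).unique
    ((((hf.hasFDerivAt_hess hz i).clm_apply (hasFDerivAt_const _ z)).clm_apply
      (hf.differentiableAt_frame2 hz j).hasFDerivAt).neg.congr_of_eventuallyEq hconn)
  simpa [hf.fderiv_frame2 hz, add_comm] using hd

lemma IsWebOn.fderiv_conn_frame2 (hf : IsWebOn f U) (hz : z ∈ U) (i j l : Fin 2) (v : M4) :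
    fderiv ℝ (conn f i j) z v (frame2 f l z) =
      -fderiv ℝ (hess f i) z v (frame1 f j z) (frame2 f l z)
        + ∑ m, hess f m z v (frame1 f j z) * hess f i z (frame1 f m z) (frame2 f l z) := by
  have hconn : (fun w => conn f i j w (frame2 f l z)) =ᶠ[𝓝 z]
      fun w => -hess f i w (frame1 f j w) (frame2 f l z) := by
    filter_upwards [hf.mem_nhds hz] with w hw
    simp only [conn_apply (hf.det_jacX_ne_zero hw) (hf.det_jacY_ne_zero hw), projX_frame2,
      projY_frame2, map_zero, zero_apply, neg_zero, zero_sub]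
  have hd := congrArg (· v) <|
    ((hf.differentiableAt_conn hz i j).hasFDerivAt.clm_apply (hasFDerivAt_const _ z)).unique
    ((((hf.hasFDerivAt_hess hz i).clm_apply
      (hf.differentiableAt_frame1 hz j).hasFDerivAt).clm_apply
      (hasFDerivAt_const _ z)).neg.congr_of_eventuallyEq hconn)
  simpa [hf.fderiv_frame1 hz, add_comm] using hd

lemma IsWebOn.curv_eq (hf : IsWebOn f U) (hz : z ∈ U) (i j k l : Fin 2) :
    curv f i j k l z =
      -fderiv ℝ (hess f i) z (frame1 f k z) (frame1 f j z) (frame2 f l z)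
      + fderiv ℝ (hess f i) z (frame2 f l z) (frame1 f k z) (frame2 f j z)
      + ∑ m, ((hess f m z (frame1 f k z) (frame1 f j z) + Gam f m k j z)
            * hess f i z (frame1 f m z) (frame2 f l z)
          - (hess f m z (frame2 f l z) (frame2 f j z) + Gam f m j l z)
            * hess f i z (frame1 f k z) (frame2 f m z)) := by
  simp only [curv, curvForm, dForm, hf.fderiv_conn_frame1 hz, hf.fderiv_conn_frame2 hz,
    conn_frame1 (hf.det_jacX_ne_zero hz), conn_frame2 (hf.det_jacY_ne_zero hz), Fin.sum_univ_two,
    Gam_eq]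
  ring

/-- The value `bⁱⱼₖₗ ξʲ ξᵏ ξˡ` of the curvature on a transversal direction. -/
noncomputable def curvCubic (f : M4 → V2) (i : Fin 2) (z : M4) (ξ : V2) : ℝ :=
  ∑ j, ∑ k, ∑ l, ξ j * ξ k * ξ l * curv f i j k l z

lemma IsWebOn.curvCubic_eq (hf : IsWebOn f U) (hz : z ∈ U) (i : Fin 2) (ξ : V2) :
    curvCubic f i z ξ =
      -fderiv ℝ (hess f i) z (frameX f z ξ) (frameX f z ξ) (frameY f z ξ)
      + fderiv ℝ (hess f i) z (frameY f z ξ) (frameX f z ξ) (frameY f z ξ)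
      + ∑ m, ((hess f m z (frameX f z ξ) (frameX f z ξ) - hess f m z (frameX f z ξ) (frameY f z ξ))
            * hess f i z (frame1 f m z) (frameY f z ξ)
          - (hess f m z (frameY f z ξ) (frameY f z ξ) - hess f m z (frameX f z ξ) (frameY f z ξ))
            * hess f i z (frameX f z ξ) (frame2 f m z)) := by
  simp only [curvCubic, hf.curv_eq hz, frameX_eq, frameY_eq, Fin.sum_univ_two, map_add, map_smul,
    add_apply, smul_apply, smul_eq_mul, Gam_eq]
  ring

/-! ### Webs with `Γ¹ + Γ² = 0` -/

lemma omega1_covDeriv (hz : (jacX f z).det ≠ 0) (P Q : M4 → ℝ) (X : M4 → M4) (i : Fin 2) (v : M4) :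
    omega1 f i z (covDeriv f P Q X z v) = fderiv ℝ (fun w => omega1 f i w (X w)) z v
      + ∑ j, theta f P Q i j z v * omega1 f j z (X z) := by
  fin_cases i <;> simp [covDeriv, omega1_frame1 hz]

lemma omega2_covDeriv (hz : (jacY f z).det ≠ 0) (P Q : M4 → ℝ) (X : M4 → M4) (i : Fin 2) (v : M4) :
    omega2 f i z (covDeriv f P Q X z v) = fderiv ℝ (fun w => omega2 f i w (X w)) z v
      + ∑ j, theta f P Q i j z v * omega2 f j z (X z) := by
  fin_cases i <;> simp [covDeriv, omega2_frame2 hz]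

lemma conn_apply_eq_zero {v : M4} (hv : ∀ k, omega1 f k z v = 0 ∧ omega2 f k z v = 0)
    (i j : Fin 2) : conn f i j z v = 0 := by
  simp [conn, hv]

/-- `Γ¹ⱼₖ + Γ²ⱼₖ = 0`, that is, the mixed second derivatives `∂²/∂xˡ∂yᵐ` of `f¹ + f²` vanish. -/
def GamSumVanishes (f : M4 → V2) (z : M4) : Prop :=
  ∀ j k, Gam f 1 j k z = -Gam f 0 j k z

lemma ParallelCond.integrabilityCond (h : ParallelCond f z) : IntegrabilityCond f z := by
  obtain ⟨hp₀, hq₀⟩ := h 0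
  obtain ⟨hp₁, hq₁⟩ := h 1
  constructor <;> linarith

namespace GamSumVanishes

lemma conn_one (h : GamSumVanishes f z) (j : Fin 2) : conn f 1 j z = -conn f 0 j z := by
  simp only [conn, h _ _, Fin.sum_univ_two]
  module

lemma torsion_one (h : GamSumVanishes f z) (j k : Fin 2) :
    torsion f 1 j k z = -torsion f 0 j k z := by
  simp only [torsion, h _ _]
  ring

lemma theta_one (h : GamSumVanishes f z) (P Q : M4 → ℝ) (j : Fin 2) :
    theta f P Q 1 j z = -theta f P Q 0 j z := by
  simp only [theta, h.conn_one, h.torsion_one, Fin.sum_univ_two]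
  module

lemma covec_eq (h : GamSumVanishes f z) (j : Fin 2) :
    covec f j z = Gam f 0 1 0 z - Gam f 0 0 1 z := by
  fin_cases j <;> simp [covec, torsion, h _ _] <;> ring

lemma equalCovecCond (h : GamSumVanishes f z) : EqualCovecCond f z :=
  ⟨by rw [h.covec_eq, h.covec_eq], fun v hv => by simp only [conn_apply_eq_zero hv]; ring⟩

lemma nablaCovec_eq (h : GamSumVanishes f z) (i : Fin 2) :
    nablaCovec f i z = fderiv ℝ (covec f i) z := by
  simp [nablaCovec, h.conn_one, h.covec_eq]

lemma parallelCond (h : ∀ᶠ w in 𝓝 z, GamSumVanishes f w) : ParallelCond f z := by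
  have hcovec : covec f 0 =ᶠ[𝓝 z] covec f 1 := h.mono fun w hw => hw.equalCovecCond.1
  intro i
  simp only [pT, qT, h.self_of_nhds.nablaCovec_eq, hcovec.fderiv_eq, and_self]

lemma curv_one (h : ∀ᶠ w in 𝓝 z, GamSumVanishes f w) (j k l : Fin 2) :
    curv f 1 j k l z = -curv f 0 j k l z := by
  have hconn : conn f 1 j =ᶠ[𝓝 z] -conn f 0 j := h.mono fun w hw => hw.conn_one j
  simp only [curv, curvForm, dForm, hconn.fderiv_eq, fderiv_neg, h.self_of_nhds.conn_one,
    Fin.sum_univ_two, neg_apply]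
  ring

lemma mem_aDist_iff (h : GamSumVanishes f z) (ha : covec f 0 z ≠ 0) (v : M4) :
    v ∈ aDist f z ↔
      omega1 f 0 z v + omega1 f 1 z v = 0 ∧ omega2 f 0 z v + omega2 f 1 z v = 0 := by
  simp [aDist, ← h.equalCovecCond.1, ← mul_add, ha]

lemma aDist_eq_transPlane (h : GamSumVanishes f z) (ha : covec f 0 z ≠ 0) :
    aDist f z = transPlane f z ![1, -1] := by
  ext v
  rw [h.mem_aDist_iff ha]
  simp [transPlane, sub_eq_zero, neg_eq_iff_add_eq_zero]

end GamSumVanishes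

lemma fderiv_add_fderiv_eq_zero {E F : Type*} [NormedAddCommGroup E] [NormedSpace ℝ E]
    [NormedAddCommGroup F] [NormedSpace ℝ F] {g h : E → F} {a : E} (hg : DifferentiableAt ℝ g a)
    (hh : DifferentiableAt ℝ h a) (hsum : ∀ᶠ w in 𝓝 a, g w + h w = 0) (v : E) :
    fderiv ℝ g a v + fderiv ℝ h a v = 0 := by
  have hzero : (fun w => g w + h w) =ᶠ[𝓝 a] fun _ => 0 := hsum
  rw [← add_apply, ← fderiv_fun_add hg hh, hzero.fderiv_eq, fderiv_fun_const]
  simp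

lemma IsWebOn.isGeodesicallyParallelOn_aDist (hf : IsWebOn f U)
    (hΓ : ∀ z ∈ U, GamSumVanishes f z) (ha : ∀ z ∈ U, covec f 0 z ≠ 0) (P Q : M4 → ℝ) :
    IsGeodesicallyParallelOn f P Q (aDist f) U := by
  intro z hz X hX hmem v
  have hker : ∀ᶠ w in 𝓝 z, omega1 f 0 w (X w) + omega1 f 1 w (X w) = 0 ∧
      omega2 f 0 w (X w) + omega2 f 1 w (X w) = 0 := by
    filter_upwards [hmem, hf.mem_nhds hz] with w hXw hw
    exact ((hΓ w hw).mem_aDist_iff (ha w hw) (X w)).1 hXw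
  have h₁ := fderiv_add_fderiv_eq_zero ((hf.differentiableAt_omega1 hz 0).clm_apply hX)
    ((hf.differentiableAt_omega1 hz 1).clm_apply hX) (hker.mono fun _ hw => hw.1) v
  have h₂ := fderiv_add_fderiv_eq_zero ((hf.differentiableAt_omega2 hz 0).clm_apply hX)
    ((hf.differentiableAt_omega2 hz 1).clm_apply hX) (hker.mono fun _ hw => hw.2) v
  simp only [(hΓ z hz).mem_aDist_iff (ha z hz), omega1_covDeriv (hf.det_jacX_ne_zero hz),
    omega2_covDeriv (hf.det_jacY_ne_zero hz), Fin.sum_univ_two, (hΓ z hz).theta_one, neg_apply]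
  constructor <;> linarith

/-! ### Transversal surfaces -/

lemma exists_eq_smul_of_mul_eq {K : Type*} [Field K] {ξ v : Fin 2 → K} (hξ : ξ ≠ 0)
    (h : ξ 1 * v 0 = ξ 0 * v 1) : ∃ c : K, v = c • ξ := by
  by_cases h₀ : ξ 0 = 0
  · have h₁ : ξ 1 ≠ 0 := fun h₁ => hξ (funext (Fin.forall_fin_two.2 ⟨h₀, h₁⟩))
    refine ⟨v 1 / ξ 1, funext (Fin.forall_fin_two.2 ⟨?_, ?_⟩)⟩
    · simpa [h₀, h₁] using h
    · simp [h₁]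
  · refine ⟨v 0 / ξ 0, funext (Fin.forall_fin_two.2 ⟨?_, ?_⟩)⟩
    · simp [h₀]
    · simp only [Pi.smul_apply, smul_eq_mul]
      field_simp
      linear_combination -h

lemma frameX_smul (f : M4 → V2) (z : M4) (c : ℝ) (ξ : V2) :
    frameX f z (c • ξ) = c • frameX f z ξ := by
  simp [frameX, Matrix.mulVec_smul]

lemma frameY_smul (f : M4 → V2) (z : M4) (c : ℝ) (ξ : V2) :
    frameY f z (c • ξ) = c • frameY f z ξ := by
  simp [frameY, Matrix.mulVec_smul]

lemma fderiv_frameX (hz : (jacX f z).det ≠ 0) (i : Fin 2) (ξ : V2) :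
    fderiv ℝ (fun w => f w i) z (frameX f z ξ) = ξ i :=
  omega1_frameX hz i ξ

lemma fderiv_frameY (hz : (jacY f z).det ≠ 0) (i : Fin 2) (ξ : V2) :
    fderiv ℝ (fun w => f w i) z (frameY f z ξ) = ξ i :=
  omega2_frameY hz i ξ

lemma IsWebOn.mem_transPlane_iff (hf : IsWebOn f U) (hz : z ∈ U) {ξ : V2} (hξ : ξ ≠ 0) {v : M4} :
    v ∈ transPlane f z ξ ↔ ∃ s t : ℝ, v = s • frameX f z ξ + t • frameY f z ξ := by
  have hX := hf.det_jacX_ne_zero hz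
  have hY := hf.det_jacY_ne_zero hz
  have hmem : v ∈ transPlane f z ξ ↔ ξ 1 * omega1 f 0 z v = ξ 0 * omega1 f 1 z v ∧
      ξ 1 * omega2 f 0 z v = ξ 0 * omega2 f 1 z v := by
    simp [transPlane, sub_eq_zero]
  rw [hmem]
  constructor
  · rintro ⟨h₁, h₂⟩
    obtain ⟨s, hs⟩ := exists_eq_smul_of_mul_eq (v := fun i => omega1 f i z v) hξ h₁
    obtain ⟨t, ht⟩ := exists_eq_smul_of_mul_eq (v := fun i => omega2 f i z v) hξ h₂
    refine ⟨s, t, ?_⟩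
    rw [← frameX_smul, ← frameY_smul, ← hs, ← ht, frameX_omega1 hX, frameY_omega2 hY,
      projX_add_projY]
  · rintro ⟨s, t, rfl⟩
    simp only [map_add, map_smul, omega1_frameX hX, omega2_frameY hY, omega1_frameY,
      omega2_frameX, smul_eq_mul, mul_zero, add_zero, zero_add]
    constructor <;> ring

/-- A surface all of whose tangent planes are transversal planes of the web. -/
def IsTransversalSurface (f : M4 → V2) (O : Set (ℝ × ℝ)) (φ : ℝ × ℝ → M4) : Prop :=
  IsSurface O φ ∧ ∀ s ∈ O, ∃ η : V2, η ≠ 0 ∧ tangentPlane φ s = transPlane f (φ s) η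

variable {O : Set (ℝ × ℝ)} {φ : ℝ × ℝ → M4} {s : ℝ × ℝ}

lemma IsSurface.hasFDerivAt (hφ : IsSurface O φ) (hs : s ∈ O) :
    HasFDerivAt φ (fderiv ℝ φ s) s :=
  ((hφ.2.1.contDiffAt (hφ.1.mem_nhds hs)).differentiableAt (by simp)).hasFDerivAt

lemma finrank_eq_one_of_disjoint {K V : Type*} [DivisionRing K] [AddCommGroup V] [Module K V]
    [FiniteDimensional K V] (hV : Module.finrank K V = 2) {A B : Submodule K V} (hA : A ≠ ⊥)
    (hB : B ≠ ⊥) (hAB : A ⊓ B = ⊥) : Module.finrank K A = 1 := by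
  have hle := Submodule.finrank_add_finrank_le_of_disjoint (disjoint_iff.2 hAB)
  have hA₁ := Submodule.one_le_finrank_iff.2 hA
  have hB₁ := Submodule.one_le_finrank_iff.2 hB
  omega

lemma IsWebOn.eq_zero_of_fderiv_eq_zero (hf : IsWebOn f U) (hz : z ∈ U) {v : M4}
    (hv : v.1 = 0 ∨ v.2 = 0) (h : ∀ i, fderiv ℝ (fun w => f w i) z v = 0) : v = 0 := by
  rw [← projX_add_projY v, ← frameX_omega1 (hf.det_jacX_ne_zero hz),
    ← frameY_omega2 (hf.det_jacY_ne_zero hz)]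
  have hω (i : Fin 2) : omega1 f i z v = 0 ∧ omega2 f i z v = 0 := by
    have hadd := omega1_add_omega2 f i z v
    rw [h i] at hadd
    rcases hv with hv | hv
    · have h₁ : omega1 f i z v = 0 := by rw [omega1_apply, hv, Prod.mk_zero_zero, map_zero]
      exact ⟨h₁, by simpa [h₁] using hadd⟩
    · have h₂ : omega2 f i z v = 0 := by rw [omega2_apply, hv, Prod.mk_zero_zero, map_zero]
      exact ⟨by simpa [h₂] using hadd, h₂⟩
  simp [hω, frameX_eq, frameY_eq]

lemma IsSurface.mem_ker_fderiv_fst (hφ : IsSurface O φ) (hs : s ∈ O) (p : ℝ × ℝ) :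
    p ∈ LinearMap.ker (fderiv ℝ (fun s => (φ s).1) s).toLinearMap ↔ (fderiv ℝ φ s p).1 = 0 := by
  rw [(hφ.hasFDerivAt hs).fst.fderiv]
  rfl

lemma IsSurface.mem_ker_fderiv_snd (hφ : IsSurface O φ) (hs : s ∈ O) (p : ℝ × ℝ) :
    p ∈ LinearMap.ker (fderiv ℝ (fun s => (φ s).2) s).toLinearMap ↔ (fderiv ℝ φ s p).2 = 0 := by
  rw [(hφ.hasFDerivAt hs).snd.fderiv]
  rfl

lemma IsWebOn.mem_ker_fderiv_comp (hf : IsWebOn f U) (hφ : IsSurface O φ) (hs : s ∈ O)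
    (hsU : φ s ∈ U) (p : ℝ × ℝ) :
    p ∈ LinearMap.ker (fderiv ℝ (fun s => f (φ s)) s).toLinearMap ↔
      ∀ i, fderiv ℝ (fun w => f w i) (φ s) (fderiv ℝ φ s p) = 0 := by
  have hcomp (i : Fin 2) := ((hf.contDiffAt hsU i).differentiableAt (by simp)).hasFDerivAt.comp s
    (hφ.hasFDerivAt hs)
  have hpi : fderiv ℝ (fun s => f (φ s)) s = ContinuousLinearMap.pi fun i =>
      (fderiv ℝ (fun w => f w i) (φ s)).comp (fderiv ℝ φ s) := (hasFDerivAt_pi.2 hcomp).fderiv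
  rw [hpi]
  simp [funext_iff]

lemma IsWebOn.smul_frameX_add_smul_frameY_eq_zero_iff (hf : IsWebOn f U) (hz : z ∈ U) {η : V2}
    (hη : η ≠ 0) {a b : ℝ} : a • frameX f z η + b • frameY f z η = 0 ↔ a = 0 ∧ b = 0 := by
  refine ⟨fun h => ?_, by rintro ⟨rfl, rfl⟩; simp⟩
  obtain ⟨i, hi⟩ := Function.ne_iff.1 hη
  have h₁ := congrArg (omega1 f i z) h
  have h₂ := congrArg (omega2 f i z) h
  simp only [map_add, map_smul, omega1_frameX (hf.det_jacX_ne_zero hz),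
    omega2_frameY (hf.det_jacY_ne_zero hz), omega1_frameY, omega2_frameX, smul_eq_mul, mul_zero,
    add_zero, zero_add, map_zero] at h₁ h₂
  exact ⟨(mul_eq_zero.1 h₁).resolve_right hi, (mul_eq_zero.1 h₂).resolve_right hi⟩

lemma IsTransversalSurface.exists_fderiv_eq (hφ : IsTransversalSurface f O φ) (hf : IsWebOn f U)
    (hs : s ∈ O) (hsU : φ s ∈ U) {a b : ℝ} (hab : ¬(a = 0 ∧ b = 0)) :
    ∃ η : V2, ∃ p ≠ 0, fderiv ℝ φ s p = a • frameX f (φ s) η + b • frameY f (φ s) η := by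
  obtain ⟨η, hη, hplane⟩ := hφ.2 s hs
  have hmem : a • frameX f (φ s) η + b • frameY f (φ s) η ∈ tangentPlane φ s :=
    hplane ▸ (hf.mem_transPlane_iff hsU hη).2 ⟨a, b, rfl⟩
  obtain ⟨p, hp⟩ := hmem
  refine ⟨η, p, ?_, hp⟩
  rintro rfl
  exact hab ((hf.smul_frameX_add_smul_frameY_eq_zero_iff hsU hη).1 (hp.symm.trans (map_zero _)))

theorem IsTransversalSurface.isPlanarWeb (hφ : IsTransversalSurface f O φ) (hf : IsWebOn f U)
    (hU : Set.MapsTo φ O U) :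
    IsPlanarWeb (fun s => (φ s).1) (fun s => (φ s).2) (fun s => f (φ s)) O := by
  refine ⟨contDiff_fst.comp_contDiffOn hφ.1.2.1, contDiff_snd.comp_contDiffOn hφ.1.2.1,
    hf.2.1.comp hφ.1.2.1 hU, fun s hs => ?_⟩
  have hfst := hφ.1.mem_ker_fderiv_fst hs
  have hsnd := hφ.1.mem_ker_fderiv_snd hs
  have hcomp := hf.mem_ker_fderiv_comp hφ.1 hs (hU hs)
  set K₁ := LinearMap.ker (fderiv ℝ (fun s => (φ s).1) s).toLinearMap
  set K₂ := LinearMap.ker (fderiv ℝ (fun s => (φ s).2) s).toLinearMap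
  set K₃ := LinearMap.ker (fderiv ℝ (fun s => f (φ s)) s).toLinearMap
  have hinj {p : ℝ × ℝ} (h : fderiv ℝ φ s p = 0) : p = 0 :=
    hφ.1.2.2 s hs (h.trans (map_zero _).symm)
  have h₁₂ : K₁ ⊓ K₂ = ⊥ := (Submodule.eq_bot_iff _).2 fun p hp =>
    hinj (Prod.ext ((hfst p).1 hp.1) ((hsnd p).1 hp.2))
  have h₁₃ : K₁ ⊓ K₃ = ⊥ := (Submodule.eq_bot_iff _).2 fun p hp =>
    hinj (hf.eq_zero_of_fderiv_eq_zero (hU hs) (.inl ((hfst p).1 hp.1)) ((hcomp p).1 hp.2))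
  have h₂₃ : K₂ ⊓ K₃ = ⊥ := (Submodule.eq_bot_iff _).2 fun p hp =>
    hinj (hf.eq_zero_of_fderiv_eq_zero (hU hs) (.inr ((hsnd p).1 hp.1)) ((hcomp p).1 hp.2))
  have hK₁ : K₁ ≠ ⊥ := by
    obtain ⟨η, p, hp₀, hp⟩ := hφ.exists_fderiv_eq hf hs (hU hs) (a := 0) (b := 1) (by simp)
    exact (Submodule.ne_bot_iff _).2 ⟨p, (hfst p).2 (by simp [hp, frameY]), hp₀⟩
  have hK₂ : K₂ ≠ ⊥ := by
    obtain ⟨η, p, hp₀, hp⟩ := hφ.exists_fderiv_eq hf hs (hU hs) (a := 1) (b := 0) (by simp)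
    exact (Submodule.ne_bot_iff _).2 ⟨p, (hsnd p).2 (by simp [hp, frameX]), hp₀⟩
  have hK₃ : K₃ ≠ ⊥ := by
    obtain ⟨η, p, hp₀, hp⟩ := hφ.exists_fderiv_eq hf hs (hU hs) (a := 1) (b := -1) (by simp)
    refine (Submodule.ne_bot_iff _).2 ⟨p, (hcomp p).2 fun i => ?_, hp₀⟩
    simp [hp, fderiv_frameX (hf.det_jacX_ne_zero (hU hs)),
      fderiv_frameY (hf.det_jacY_ne_zero (hU hs))]
  have hdim : Module.finrank ℝ (ℝ × ℝ) = 2 := by simp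
  exact ⟨finrank_eq_one_of_disjoint hdim hK₁ hK₂ h₁₂, finrank_eq_one_of_disjoint hdim hK₂ hK₃ h₂₃,
    finrank_eq_one_of_disjoint hdim hK₃ hK₁ (inf_comm K₃ K₁ ▸ h₁₃), h₁₂, h₁₃, h₂₃⟩

end

section

variable {f : M4 → V2} {U : Set M4} {z : M4} {O : Set (ℝ × ℝ)} {φ : ℝ × ℝ → M4} {ξ : V2}
  {E F : Type*} [NormedAddCommGroup E] [NormedSpace ℝ E] [NormedAddCommGroup F] [NormedSpace ℝ F]

lemma eventually_eq_comp_of_fderiv_eq_zero {B : E → F} (π : E →L[ℝ] E) (hπ : ∀ v, π (π v) = π v)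
    (hB : ∀ᶠ p in 𝓝 0, DifferentiableAt ℝ B p ∧ ∀ v, π v = 0 → fderiv ℝ B p v = 0) :
    ∀ᶠ p in 𝓝 0, B p = B (π p) := by
  obtain ⟨ε, hε, hball⟩ := Metric.eventually_nhds_iff_ball.1 hB
  have hπ₀ : Filter.Tendsto π (𝓝 0) (𝓝 0) := by simpa using π.continuous.tendsto 0
  filter_upwards [Metric.ball_mem_nhds 0 hε, hπ₀ (Metric.ball_mem_nhds 0 hε)] with p hp hπp
  have hline (t : ℝ) (ht : t ∈ Set.Icc (0 : ℝ) 1) :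
      HasDerivAt (fun t => B (AffineMap.lineMap (π p) p t)) 0 t := by
    have hmem := (convex_ball (0 : E) ε).lineMap_mem hπp hp ht
    have hzero := (hball _ hmem).2 (p - π p) (by rw [map_sub, hπ, sub_self])
    exact hzero ▸ (hball _ hmem).1.hasFDerivAt.comp_hasDerivAt t AffineMap.hasDerivAt_lineMap
  have hle := (convex_Icc (0 : ℝ) 1).norm_image_sub_le_of_norm_hasDerivWithin_le (C := 0)
    (fun t ht => (hline t ht).hasDerivWithinAt) (by simp) (Set.left_mem_Icc.2 zero_le_one)
    (Set.right_mem_Icc.2 zero_le_one)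
  simpa [sub_eq_zero] using hle

lemma IsSurface.exists_comp_chart (hφ : IsSurface O φ) {s : ℝ × ℝ} (hs : s ∈ O)
    (L : M4 →L[ℝ] ℝ × ℝ) (hL : Function.Injective (L ∘ fderiv ℝ φ s)) :
    ∃ g : ℝ × ℝ → ℝ × ℝ, ContDiffAt ℝ ∞ g 0 ∧ g 0 = s ∧ ∀ᶠ p in 𝓝 0, L (φ (g p) - φ s) = p := by
  have hsmooth : ContDiffAt ℝ ∞ (fun p => L (φ p - φ s)) s :=
    L.contDiff.contDiffAt.comp s
      ((hφ.2.1.contDiffAt (hφ.1.mem_nhds hs)).sub contDiffAt_const)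
  let e : (ℝ × ℝ) ≃L[ℝ] ℝ × ℝ :=
    (LinearEquiv.ofInjectiveEndo (L.comp (fderiv ℝ φ s)).toLinearMap hL).toContinuousLinearEquiv
  have he : HasFDerivAt (fun p => L (φ p - φ s)) (e : ℝ × ℝ →L[ℝ] ℝ × ℝ) s :=
    L.hasFDerivAt.comp s ((hφ.hasFDerivAt hs).sub_const (φ s))
  have hzero : L (φ s - φ s) = 0 := by rw [sub_self, map_zero]
  refine ⟨hsmooth.localInverse he (by simp), ?_, ?_, ?_⟩
  · exact hzero ▸ hsmooth.to_localInverse he (by simp)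
  · exact hzero ▸ hsmooth.localInverse_apply_image he (by simp)
  · exact hzero ▸ (hsmooth.hasStrictFDerivAt' he (by simp)).eventually_right_inverse

lemma frameX_snd (f : M4 → V2) (z : M4) (ξ : V2) : (frameX f z ξ).2 = 0 := rfl

lemma frameY_fst (f : M4 → V2) (z : M4) (ξ : V2) : (frameY f z ξ).1 = 0 := rfl

lemma IsWebOn.frameX_fst_ne_zero (hf : IsWebOn f U) (hz : z ∈ U) (hξ : ξ ≠ 0) :
    (frameX f z ξ).1 ≠ 0 := fun h => by
  simpa using (hf.smul_frameX_add_smul_frameY_eq_zero_iff hz hξ (a := 1) (b := 0)).1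
    (by simpa using Prod.ext h (frameX_snd f z ξ))

lemma IsWebOn.frameY_snd_ne_zero (hf : IsWebOn f U) (hz : z ∈ U) (hξ : ξ ≠ 0) :
    (frameY f z ξ).2 ≠ 0 := fun h => by
  simpa using (hf.smul_frameX_add_smul_frameY_eq_zero_iff hz hξ (a := 0) (b := 1)).1
    (by simpa using Prod.ext (frameY_fst f z ξ) h)

lemma IsSurface.exists_chart (hφ : IsSurface O φ) {s : ℝ × ℝ} (hs : s ∈ O)
    (L : M4 →L[ℝ] ℝ × ℝ) (hL : Function.Injective (L ∘ fderiv ℝ φ s)) :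
    ∃ g : ℝ × ℝ → ℝ × ℝ, ContDiffAt ℝ ∞ (φ ∘ g) 0 ∧ g 0 = s ∧ ∀ᶠ p in 𝓝 0, g p ∈ O ∧
      (∀ v, fderiv ℝ (φ ∘ g) p v ∈ tangentPlane φ (g p)) ∧
      ∀ v, L (fderiv ℝ (φ ∘ g) p v) = v := by
  obtain ⟨g, hg, hg₀, hLg⟩ := hφ.exists_comp_chart hs L hL
  have hmem : ∀ᶠ p in 𝓝 0, g p ∈ O :=
    hg.continuousAt.eventually_mem (hφ.1.mem_nhds (hg₀.symm ▸ hs))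
  have hφg : ContDiffAt ℝ ∞ (φ ∘ g) 0 :=
    (hφ.2.1.contDiffAt (hφ.1.mem_nhds (hg₀.symm ▸ hs))).comp 0 hg
  have hdiff : ∀ᶠ p in 𝓝 0, ContDiffAt ℝ 1 g p :=
    (hg.of_le (by simp)).eventually (by simp)
  refine ⟨g, hφg, hg₀, ?_⟩
  filter_upwards [hmem, hdiff, hLg.eventually_nhds] with p hp hgp hLp
  have hder := (hφ.hasFDerivAt hp).comp p (hgp.differentiableAt (by simp)).hasFDerivAt
  refine ⟨hp, fun v => ?_, fun v => ?_⟩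
  · rw [hder.fderiv]
    exact LinearMap.mem_range_self _ _
  · have hid : HasFDerivAt (fun p => L (φ (g p) - φ s)) (ContinuousLinearMap.id ℝ (ℝ × ℝ)) p :=
      (hasFDerivAt_id p).congr_of_eventuallyEq hLp
    have heq := (L.hasFDerivAt.comp p (hder.sub_const (φ s))).unique hid
    rw [hder.fderiv]
    exact DFunLike.congr_fun heq v

lemma IsWebOn.eq_smul_add_smul_of_mem_transPlane (hf : IsWebOn f U) (hz : z ∈ U)
    (hξ : ξ ≠ 0) {ℓ m : V2 →L[ℝ] ℝ} {D : ℝ × ℝ →L[ℝ] M4} (hD : ∀ v, D v ∈ transPlane f z ξ)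
    (hℓ : ∀ v, ℓ (D v).1 = v.1) (hm : ∀ v, m (D v).2 = v.2) (v : ℝ × ℝ) :
    D v = (v.1 * (ℓ (frameX f z ξ).1)⁻¹) • frameX f z ξ
      + (v.2 * (m (frameY f z ξ).2)⁻¹) • frameY f z ξ := by
  have key (v : ℝ × ℝ) : ∃ s t : ℝ, D v = s • frameX f z ξ + t • frameY f z ξ ∧
      s * ℓ (frameX f z ξ).1 = v.1 ∧ t * m (frameY f z ξ).2 = v.2 := by
    obtain ⟨s, t, h⟩ := (hf.mem_transPlane_iff hz hξ).1 (hD v)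
    refine ⟨s, t, h, ?_, ?_⟩
    · simpa [h, frameY_fst] using hℓ v
    · simpa [h, frameX_snd] using hm v
  obtain ⟨s₁, t₁, -, hs₁, ht₁⟩ := key (1, 1)
  obtain ⟨s, t, h, hs, ht⟩ := key v
  rw [h, ← hs, ← ht, mul_inv_cancel_right₀ (right_ne_zero_of_mul_eq_one hs₁),
    mul_inv_cancel_right₀ (right_ne_zero_of_mul_eq_one ht₁)]

lemma IsTransversalSurface.exists_frame_param (hφ : IsTransversalSurface f O φ)
    (hf : IsWebOn f U) (hU : Set.MapsTo φ O U) {s : ℝ × ℝ} (hs : s ∈ O) (hξ : ξ ≠ 0)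
    (hplane : tangentPlane φ s = transPlane f (φ s) ξ) :
    ∃ ψ : ℝ × ℝ → M4, ContDiffAt ℝ ∞ ψ 0 ∧ ψ 0 = φ s ∧
      (∀ v, fderiv ℝ ψ 0 v = v.1 • frameX f (φ s) ξ + v.2 • frameY f (φ s) ξ) ∧
      ∀ᶠ p in 𝓝 0, ψ p ∈ U ∧ ∃ (η : V2) (a b : ℝ), ∀ v, fderiv ℝ ψ p v =
        (v.1 * a) • frameX f (ψ p) η + (v.2 * b) • frameY f (ψ p) η := by
  obtain ⟨ℓ, hℓ⟩ := SeparatingDual.exists_eq_one (R := ℝ) (hf.frameX_fst_ne_zero (hU hs) hξ)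
  obtain ⟨m, hm⟩ := SeparatingDual.exists_eq_one (R := ℝ) (hf.frameY_snd_ne_zero (hU hs) hξ)
  have hinj : Function.Injective (ℓ.prodMap m ∘ fderiv ℝ φ s) := by
    refine (injective_iff_map_eq_zero ((ℓ.prodMap m).comp (fderiv ℝ φ s))).2 fun v hv => ?_
    have hmem : fderiv ℝ φ s v ∈ transPlane f (φ s) ξ := hplane ▸ LinearMap.mem_range_self _ v
    obtain ⟨a, b, hab⟩ := (hf.mem_transPlane_iff (hU hs) hξ).1 hmem
    have hv' : a = 0 ∧ b = 0 := by
      simpa [hab, frameX_snd, frameY_fst, hℓ, hm, Prod.ext_iff] using hv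
    exact hφ.1.2.2 s hs (by simp [hab, hv'])
  obtain ⟨g, hg, hg₀, hev⟩ := hφ.1.exists_chart hs _ hinj
  have key (v : ℝ × ℝ) (p : ℝ × ℝ) (h : ℓ.prodMap m (fderiv ℝ (φ ∘ g) p v) = v) :
      ℓ (fderiv ℝ (φ ∘ g) p v).1 = v.1 ∧ m (fderiv ℝ (φ ∘ g) p v).2 = v.2 :=
    Prod.ext_iff.1 h
  refine ⟨φ ∘ g, hg, by simp [hg₀], fun v => ?_, ?_⟩
  · obtain ⟨-, htan, hLder⟩ := hev.self_of_nhds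
    rw [hg₀, hplane] at htan
    rw [hf.eq_smul_add_smul_of_mem_transPlane (hU hs) hξ htan (fun v => (key v 0 (hLder v)).1)
      (fun v => (key v 0 (hLder v)).2), hℓ, hm]
    simp
  · filter_upwards [hev] with p ⟨hp, htan, hLder⟩
    obtain ⟨η, hη, hplane'⟩ := hφ.2 _ hp
    rw [hplane'] at htan
    exact ⟨hU hp, η, _, _, hf.eq_smul_add_smul_of_mem_transPlane (hU hp) hη htan
      (fun v => (key v p (hLder v)).1) (fun v => (key v p (hLder v)).2)⟩

/-- The surface `(u, w) ↦ (X u, Y w)` swept out by a curve `X` of the first factor and a curve `Y`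
of the second one has transversal tangent planes near `(0, 0)`, and at the point `z = (X 0, Y 0)`
its parameter directions are `ξⁱ E₁ᵢ` and `ξⁱ E₂ᵢ`. -/
structure IsTransversalProduct (f : M4 → V2) (z : M4) (ξ : V2) (X Y : ℝ → V2) : Prop where
  contDiffAt_fst : ContDiffAt ℝ ∞ X 0
  contDiffAt_snd : ContDiffAt ℝ ∞ Y 0
  base : (X 0, Y 0) = z
  deriv_fst : (deriv X 0, (0 : V2)) = frameX f z ξ
  deriv_snd : ((0 : V2), deriv Y 0) = frameY f z ξ
  parallel : ∀ᶠ p : ℝ × ℝ in 𝓝 0,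
    fderiv ℝ (fun w => f w 0) (X p.1, Y p.2) (deriv X p.1, 0) *
        fderiv ℝ (fun w => f w 1) (X p.1, Y p.2) (0, deriv Y p.2) =
      fderiv ℝ (fun w => f w 1) (X p.1, Y p.2) (deriv X p.1, 0) *
        fderiv ℝ (fun w => f w 0) (X p.1, Y p.2) (0, deriv Y p.2)

lemma hasDerivAt_of_eventually_eq_fst {ψ : ℝ × ℝ → E × F} {X : ℝ → E} {p : ℝ × ℝ}
    (hψ : DifferentiableAt ℝ ψ p) (h : ∀ᶠ q in 𝓝 p, (ψ q).1 = X q.1) :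
    HasDerivAt X (fderiv ℝ ψ p (1, 0)).1 p.1 := by
  have hcurve : HasDerivAt (fun t : ℝ => (t, p.2)) (1, 0) p.1 :=
    (hasDerivAt_id p.1).prodMk (hasDerivAt_const p.1 p.2)
  have hcomp := (hψ.hasFDerivAt.fst.comp_hasDerivAt p.1 hcurve)
  exact hcomp.congr_of_eventuallyEq ((hcurve.continuousAt.eventually h).mono fun t ht => ht.symm)

lemma hasDerivAt_of_eventually_eq_snd {ψ : ℝ × ℝ → E × F} {Y : ℝ → F} {p : ℝ × ℝ}
    (hψ : DifferentiableAt ℝ ψ p) (h : ∀ᶠ q in 𝓝 p, (ψ q).2 = Y q.2) :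
    HasDerivAt Y (fderiv ℝ ψ p (0, 1)).2 p.2 := by
  have hcurve : HasDerivAt (fun t : ℝ => (p.1, t)) (0, 1) p.2 :=
    (hasDerivAt_const p.2 p.1).prodMk (hasDerivAt_id p.2)
  have hcomp := (hψ.hasFDerivAt.snd.comp_hasDerivAt p.2 hcurve)
  exact hcomp.congr_of_eventuallyEq ((hcurve.continuousAt.eventually h).mono fun t ht => ht.symm)

lemma eventually_fst_eq_and_snd_eq_of_fderiv {ψ : ℝ × ℝ → E × F}
    (hψ : ∀ᶠ p in 𝓝 0, DifferentiableAt ℝ ψ p)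
    (h₁ : ∀ᶠ p in 𝓝 0, ∀ v : ℝ × ℝ, v.1 = 0 → (fderiv ℝ ψ p v).1 = 0)
    (h₂ : ∀ᶠ p in 𝓝 0, ∀ v : ℝ × ℝ, v.2 = 0 → (fderiv ℝ ψ p v).2 = 0) :
    ∀ᶠ p in 𝓝 0, (ψ p).1 = (ψ (p.1, 0)).1 ∧ (ψ p).2 = (ψ (0, p.2)).2 := by
  have hfst := eventually_eq_comp_of_fderiv_eq_zero (B := fun p => (ψ p).1)
    ((ContinuousLinearMap.inl ℝ ℝ ℝ).comp (.fst ℝ ℝ ℝ)) (fun v => rfl) <| by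
      filter_upwards [hψ, h₁] with p hp hp₁
      refine ⟨hp.fst, fun v hv => ?_⟩
      rw [hp.hasFDerivAt.fst.fderiv]
      exact hp₁ v (congrArg Prod.fst hv)
  have hsnd := eventually_eq_comp_of_fderiv_eq_zero (B := fun p => (ψ p).2)
    ((ContinuousLinearMap.inr ℝ ℝ ℝ).comp (.snd ℝ ℝ ℝ)) (fun v => rfl) <| by
      filter_upwards [hψ, h₂] with p hp hp₂
      refine ⟨hp.snd, fun v hv => ?_⟩
      rw [hp.hasFDerivAt.snd.fderiv]
      exact hp₂ v (congrArg Prod.snd hv)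
  exact hfst.and hsnd

theorem IsTransversalSurface.exists_isTransversalProduct (hφ : IsTransversalSurface f O φ)
    (hf : IsWebOn f U) (hU : Set.MapsTo φ O U) {s : ℝ × ℝ} (hs : s ∈ O) (hξ : ξ ≠ 0)
    (hplane : tangentPlane φ s = transPlane f (φ s) ξ) :
    ∃ X Y : ℝ → V2, IsTransversalProduct f (φ s) ξ X Y := by
  obtain ⟨ψ, hψ, hψ₀, hder₀, hder⟩ := hφ.exists_frame_param hf hU hs hξ hplane
  have hdiff : ∀ᶠ p in 𝓝 0, DifferentiableAt ℝ ψ p :=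
    ((hψ.of_le (m := 1) (by simp)).eventually (by simp)).mono fun p hp =>
      hp.differentiableAt (by simp)
  have hprod := eventually_fst_eq_and_snd_eq_of_fderiv hdiff
    (hder.mono fun p ⟨_, η, a, b, h⟩ v hv => by simp [h, hv, frameY_fst])
    (hder.mono fun p ⟨_, η, a, b, h⟩ v hv => by simp [h, hv, frameX_snd])
  have hderiv := hdiff.and hprod.eventually_nhds |>.mono fun p hp => And.intro
    (hasDerivAt_of_eventually_eq_fst (X := fun t => (ψ (t, 0)).1) hp.1
      (hp.2.mono fun _ h => h.1)).deriv
    (hasDerivAt_of_eventually_eq_snd (Y := fun t => (ψ (0, t)).2) hp.1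
      (hp.2.mono fun _ h => h.2)).deriv
  refine ⟨fun t => (ψ (t, 0)).1, fun t => (ψ (0, t)).2, ⟨?_, ?_, hψ₀, ?_, ?_, ?_⟩⟩
  · exact (hψ.comp (f := fun t => (t, 0)) 0 (contDiff_prodMk_left 0).contDiffAt).fst
  · exact (hψ.comp (f := fun t => (0, t)) 0 (contDiff_prodMk_right 0).contDiffAt).snd
  · exact Prod.ext (hderiv.self_of_nhds.1.trans (by simp [hder₀])) (frameX_snd ..).symm
  · exact Prod.ext (frameY_fst ..).symm (hderiv.self_of_nhds.2.trans (by simp [hder₀]))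
  · filter_upwards [hder, hprod, hderiv] with p ⟨hpU, η, a, b, h⟩ ⟨h₁, h₂⟩ ⟨hX, hY⟩
    have hXp : (deriv (fun t => (ψ (t, 0)).1) p.1, (0 : V2)) = a • frameX f (ψ p) η :=
      Prod.ext (by simp [hX, h]) (by simp [frameX_snd])
    have hYp : ((0 : V2), deriv (fun t => (ψ (0, t)).2) p.2) = b • frameY f (ψ p) η :=
      Prod.ext (by simp [frameY_fst]) (by simp [hY, h])
    have hψp : ((ψ (p.1, 0)).1, (ψ (0, p.2)).2) = ψ p := Prod.ext h₁.symm h₂.symm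
    rw [hXp, hYp, hψp]
    simp only [map_smul, fderiv_frameX (hf.det_jacX_ne_zero hpU),
      fderiv_frameY (hf.det_jacY_ne_zero hpU), smul_eq_mul]
    ring

end

section

variable {f : M4 → V2} {U : Set M4} {z : M4} {ξ : V2} {X Y : ℝ → V2}

lemma IsWebOn.hasDerivAt_fderiv_comp (hf : IsWebOn f U) {γ v : ℝ → M4} {t : ℝ} {γ' v' : M4}
    (ht : γ t ∈ U) (hγ : HasDerivAt γ γ' t) (hv : HasDerivAt v v' t) (i : Fin 2) :
    HasDerivAt (fun u => fderiv ℝ (fun w => f w i) (γ u) (v u))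
      (hess f i (γ t) γ' (v t) + fderiv ℝ (fun w => f w i) (γ t) v') t :=
  ((hf.hasFDerivAt_fderiv ht i).comp_hasDerivAt t hγ).clm_apply hv

lemma IsWebOn.hasDerivAt_hess_comp (hf : IsWebOn f U) {γ v : ℝ → M4} {t : ℝ} {γ' v' : M4}
    (ht : γ t ∈ U) (hγ : HasDerivAt γ γ' t) (hv : HasDerivAt v v' t) (i : Fin 2) (w : M4) :
    HasDerivAt (fun u => hess f i (γ u) (v u) w)
      (fderiv ℝ (hess f i) (γ t) γ' (v t) w + hess f i (γ t) v' w) t := by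
  have hv₁ : HasDerivAt (fun u => hess f i (γ u) (v u))
      (fderiv ℝ (hess f i) (γ t) γ' (v t) + hess f i (γ t) v') t :=
    HasDerivAt.clm_apply (c := fun u => hess f i (γ u)) (c' := fderiv ℝ (hess f i) (γ t) γ')
      ((hf.hasFDerivAt_hess ht i).comp_hasDerivAt t hγ) hv
  simpa only [add_apply, map_zero, add_zero] using hv₁.clm_apply (hasDerivAt_const t w)

lemma IsWebOn.hess_add_fderiv_of_parallel (hf : IsWebOn f U) {γ v w : ℝ → M4} {t : ℝ}
    {γ' v' w' : M4} (ht : γ t ∈ U) (hγ : HasDerivAt γ γ' t) (hv : HasDerivAt v v' t)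
    (hw : HasDerivAt w w' t)
    (hpar : ∀ᶠ u in 𝓝 t, fderiv ℝ (fun w => f w 0) (γ u) (v u) *
        fderiv ℝ (fun w => f w 1) (γ u) (w u) =
      fderiv ℝ (fun w => f w 1) (γ u) (v u) * fderiv ℝ (fun w => f w 0) (γ u) (w u)) :
    (hess f 0 (γ t) γ' (v t) + fderiv ℝ (fun w => f w 0) (γ t) v') *
          fderiv ℝ (fun w => f w 1) (γ t) (w t) +
        fderiv ℝ (fun w => f w 0) (γ t) (v t) *
          (hess f 1 (γ t) γ' (w t) + fderiv ℝ (fun w => f w 1) (γ t) w') =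
      (hess f 1 (γ t) γ' (v t) + fderiv ℝ (fun w => f w 1) (γ t) v') *
          fderiv ℝ (fun w => f w 0) (γ t) (w t) +
        fderiv ℝ (fun w => f w 1) (γ t) (v t) *
          (hess f 0 (γ t) γ' (w t) + fderiv ℝ (fun w => f w 0) (γ t) w') := by
  have hFv := hf.hasDerivAt_fderiv_comp ht hγ hv
  have hFw := hf.hasDerivAt_fderiv_comp ht hγ hw
  exact ((hFv 0).mul (hFw 1)).unique (((hFv 1).mul (hFw 0)).congr_of_eventuallyEq hpar)

lemma hasDerivAt_deriv_of_contDiffAt {F : Type*} [NormedAddCommGroup F] [NormedSpace ℝ F]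
    {g : ℝ → F} {t : ℝ} (hg : ContDiffAt ℝ ∞ g t) :
    HasDerivAt (deriv g) (deriv (deriv g) t) t :=
  (ContDiffAt.differentiableAt (ContDiffAt.derivWithin (m := 1) hg
    (by norm_num; exact ENat.LEInfty.out)) (by simp)).hasDerivAt

namespace IsTransversalProduct

lemma hasDerivAt_curve_fst (h : IsTransversalProduct f z ξ X Y) :
    HasDerivAt (fun u => (X u, Y 0)) (frameX f z ξ) 0 :=
  h.deriv_fst ▸ ((h.contDiffAt_fst.differentiableAt (by simp)).hasDerivAt).prodMk
    (hasDerivAt_const 0 (Y 0))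

lemma hasDerivAt_curve_snd (h : IsTransversalProduct f z ξ X Y) (x : V2) :
    HasDerivAt (fun u => (x, Y u)) (frameY f z ξ) 0 :=
  h.deriv_snd ▸ (hasDerivAt_const 0 x).prodMk
    ((h.contDiffAt_snd.differentiableAt (by simp)).hasDerivAt)

lemma hasDerivAt_velocity_fst (h : IsTransversalProduct f z ξ X Y) :
    HasDerivAt (fun u => (deriv X u, (0 : V2))) (deriv (deriv X) 0, 0) 0 :=
  (hasDerivAt_deriv_of_contDiffAt h.contDiffAt_fst).prodMk (hasDerivAt_const 0 0)

lemma hasDerivAt_velocity_snd (h : IsTransversalProduct f z ξ X Y) :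
    HasDerivAt (fun u => ((0 : V2), deriv Y u)) (0, deriv (deriv Y) 0) 0 :=
  (hasDerivAt_const 0 0).prodMk (hasDerivAt_deriv_of_contDiffAt h.contDiffAt_snd)

lemma eventually_mem (h : IsTransversalProduct f z ξ X Y) (hf : IsWebOn f U) (hz : z ∈ U) :
    ∀ᶠ u in 𝓝 0, (X u, Y 0) ∈ U :=
  h.hasDerivAt_curve_fst.continuousAt.eventually_mem (hf.1.mem_nhds (h.base.symm ▸ hz))

lemma eventually_parallel_fst (h : IsTransversalProduct f z ξ X Y) :
    ∀ᶠ u in 𝓝 0, fderiv ℝ (fun w => f w 0) (X u, Y 0) (deriv X u, 0) *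
        fderiv ℝ (fun w => f w 1) (X u, Y 0) (frameY f z ξ) =
      fderiv ℝ (fun w => f w 1) (X u, Y 0) (deriv X u, 0) *
        fderiv ℝ (fun w => f w 0) (X u, Y 0) (frameY f z ξ) :=
  h.deriv_snd ▸
    ((Continuous.prodMk_left (0 : ℝ)).tendsto' 0 (0 : ℝ × ℝ) rfl).eventually h.parallel

lemma eventually_parallel_snd (h : IsTransversalProduct f z ξ X Y) (hf : IsWebOn f U)
    (hz : z ∈ U) : ∀ᶠ u in 𝓝 0,
    hess f 0 (X u, Y 0) (deriv X u, 0) (frameY f z ξ) *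
          fderiv ℝ (fun w => f w 1) (X u, Y 0) (frameY f z ξ) +
        fderiv ℝ (fun w => f w 0) (X u, Y 0) (deriv X u, 0) *
          (hess f 1 (X u, Y 0) (frameY f z ξ) (frameY f z ξ) +
            fderiv ℝ (fun w => f w 1) (X u, Y 0) (0, deriv (deriv Y) 0)) =
      hess f 1 (X u, Y 0) (deriv X u, 0) (frameY f z ξ) *
          fderiv ℝ (fun w => f w 0) (X u, Y 0) (frameY f z ξ) +
        fderiv ℝ (fun w => f w 1) (X u, Y 0) (deriv X u, 0) *
          (hess f 0 (X u, Y 0) (frameY f z ξ) (frameY f z ξ) +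
            fderiv ℝ (fun w => f w 0) (X u, Y 0) (0, deriv (deriv Y) 0)) := by
  have hpar : ∀ᶠ u in 𝓝 (0 : ℝ), ∀ᶠ p in 𝓝 (u, (0 : ℝ)), _ :=
    ((Continuous.prodMk_left (0 : ℝ)).tendsto' 0 (0 : ℝ × ℝ) rfl).eventually
      h.parallel.eventually_nhds
  filter_upwards [hpar, h.eventually_mem hf hz] with u hu hmem
  have hline : Filter.Tendsto (Prod.mk u) (𝓝 (0 : ℝ)) (𝓝 (u, 0)) :=
    (Continuous.prodMk_right u).tendsto 0
  have key := hf.hess_add_fderiv_of_parallel (t := 0) (γ := fun t => (X u, Y t)) hmem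
    (h.hasDerivAt_curve_snd (X u)) (hasDerivAt_const 0 (deriv X u, (0 : V2)))
    h.hasDerivAt_velocity_snd (hline.eventually hu)
  simpa only [map_zero, add_zero, h.deriv_snd, hf.hess_comm hmem _ (frameY f z ξ)] using key

lemma exists_acceleration_fst (h : IsTransversalProduct f z ξ X Y) (hf : IsWebOn f U)
    (hz : z ∈ U) (hξ : ξ ≠ 0) : ∃ κ : ℝ, (deriv (deriv X) 0, (0 : V2)) = frameX f z fun i =>
      κ * ξ i + hess f i z (frameX f z ξ) (frameY f z ξ)
        - hess f i z (frameX f z ξ) (frameX f z ξ) := by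
  have key := hf.hess_add_fderiv_of_parallel (t := 0) (h.base ▸ hz) h.hasDerivAt_curve_fst
    h.hasDerivAt_velocity_fst (hasDerivAt_const 0 (frameY f z ξ)) h.eventually_parallel_fst
  simp only [h.base, h.deriv_fst, map_zero, add_zero, fderiv_frameX (hf.det_jacX_ne_zero hz),
    fderiv_frameY (hf.det_jacY_ne_zero hz)] at key
  obtain ⟨κ, hκ⟩ := exists_eq_smul_of_mul_eq hξ (v := fun i =>
    hess f i z (frameX f z ξ) (frameX f z ξ) + fderiv ℝ (fun w => f w i) z (deriv (deriv X) 0, 0)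
      - hess f i z (frameX f z ξ) (frameY f z ξ)) (by linear_combination key)
  refine ⟨κ, (frameX_omega1 (hf.det_jacX_ne_zero hz) (deriv (deriv X) 0, 0)).symm.trans ?_⟩
  congr 1 with i
  have hκi := congrFun hκ i
  simp only [Pi.smul_apply, smul_eq_mul] at hκi
  rw [omega1_apply]
  linear_combination hκi

lemma exists_acceleration_snd (h : IsTransversalProduct f z ξ X Y) (hf : IsWebOn f U)
    (hz : z ∈ U) (hξ : ξ ≠ 0) : ∃ κ : ℝ, ((0 : V2), deriv (deriv Y) 0) = frameY f z fun i =>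
      κ * ξ i + hess f i z (frameX f z ξ) (frameY f z ξ)
        - hess f i z (frameY f z ξ) (frameY f z ξ) := by
  have key := (h.eventually_parallel_snd hf hz).self_of_nhds
  simp only [h.base, h.deriv_fst, fderiv_frameX (hf.det_jacX_ne_zero hz),
    fderiv_frameY (hf.det_jacY_ne_zero hz)] at key
  obtain ⟨κ, hκ⟩ := exists_eq_smul_of_mul_eq hξ (v := fun i =>
    hess f i z (frameY f z ξ) (frameY f z ξ) + fderiv ℝ (fun w => f w i) z (0, deriv (deriv Y) 0)
      - hess f i z (frameX f z ξ) (frameY f z ξ)) (by linear_combination -key)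
  refine ⟨κ, (frameY_omega2 (hf.det_jacY_ne_zero hz) (0, deriv (deriv Y) 0)).symm.trans ?_⟩
  congr 1 with i
  have hκi := congrFun hκ i
  simp only [Pi.smul_apply, smul_eq_mul] at hκi
  rw [omega2_apply]
  linear_combination hκi

lemma third_order_parallel (h : IsTransversalProduct f z ξ X Y) (hf : IsWebOn f U)
    (hz : z ∈ U) {x y a b : M4} (hx : frameX f z ξ = x) (hy : frameY f z ξ = y)
    (ha : (deriv (deriv X) 0, 0) = a) (hb : (0, deriv (deriv Y) 0) = b) :
    ξ 1 * (fderiv ℝ (hess f 0) z x x y + hess f 0 z a y)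
        + (hess f 0 z x x + fderiv ℝ (fun w => f w 0) z a)
          * (hess f 1 z y y + fderiv ℝ (fun w => f w 1) z b)
        + ξ 0 * (fderiv ℝ (hess f 1) z x y y + hess f 1 z x b) =
      ξ 0 * (fderiv ℝ (hess f 1) z x x y + hess f 1 z a y)
        + (hess f 1 z x x + fderiv ℝ (fun w => f w 1) z a)
          * (hess f 0 z y y + fderiv ℝ (fun w => f w 0) z b)
        + ξ 1 * (fderiv ℝ (hess f 0) z x y y + hess f 0 z x b) := by
  have hmem : (X 0, Y 0) ∈ U := h.base.symm ▸ hz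
  have hcurve := h.hasDerivAt_curve_fst
  have hF := hf.hasDerivAt_fderiv_comp hmem hcurve h.hasDerivAt_velocity_fst
  have hH := hf.hasDerivAt_hess_comp hmem hcurve h.hasDerivAt_velocity_fst
  have hFy := hf.hasDerivAt_fderiv_comp hmem hcurve (hasDerivAt_const 0 (frameY f z ξ))
  have hFb := hf.hasDerivAt_fderiv_comp hmem hcurve
    (hasDerivAt_const 0 ((0 : V2), deriv (deriv Y) 0))
  have hHy (i : Fin 2) := hf.hasDerivAt_hess_comp hmem hcurve
    (hasDerivAt_const 0 (frameY f z ξ)) i (frameY f z ξ)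
  have key := (((hH 0 (frameY f z ξ)).mul (hFy 1)).add ((hF 0).mul ((hHy 1).add (hFb 1)))).unique
    ((((hH 1 (frameY f z ξ)).mul (hFy 0)).add
      ((hF 1).mul ((hHy 0).add (hFb 0)))).congr_of_eventuallyEq (h.eventually_parallel_snd hf hz))
  simp only [Pi.add_apply, h.base, h.deriv_fst, map_zero, add_zero, zero_apply, hx, hy, ha,
    hb] at key
  have hFx (i : Fin 2) : fderiv ℝ (fun w => f w i) z x = ξ i :=
    hx ▸ fderiv_frameX (hf.det_jacX_ne_zero hz) i ξ
  have hFy (i : Fin 2) : fderiv ℝ (fun w => f w i) z y = ξ i :=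
    hy ▸ fderiv_frameY (hf.det_jacY_ne_zero hz) i ξ
  simp only [hFx, hFy] at key
  linear_combination key

theorem mul_curvCubic_eq (h : IsTransversalProduct f z ξ X Y) (hf : IsWebOn f U) (hz : z ∈ U)
    (hξ : ξ ≠ 0) : ξ 1 * curvCubic f 0 z ξ = ξ 0 * curvCubic f 1 z ξ := by
  obtain ⟨κ, hκ⟩ := h.exists_acceleration_fst hf hz hξ
  obtain ⟨μ, hμ⟩ := h.exists_acceleration_snd hf hz hξ
  have key := h.third_order_parallel hf hz rfl rfl hκ hμ
  have hX (η : V2) (i : Fin 2) : hess f i z (frameX f z η) (frameY f z ξ) =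
      ∑ m, η m * hess f i z (frame1 f m z) (frameY f z ξ) := by
    conv_lhs => rw [frameX_eq f z η]
    simp
  have hY (η : V2) (i : Fin 2) : hess f i z (frameX f z ξ) (frameY f z η) =
      ∑ m, η m * hess f i z (frameX f z ξ) (frame2 f m z) := by
    conv_lhs => rw [frameY_eq f z η]
    simp
  have hξX := hX ξ
  have hξY := hY ξ
  rw [hX _ 0, hX _ 1, hY _ 0, hY _ 1] at key
  simp only [fderiv_frameX (hf.det_jacX_ne_zero hz), fderiv_frameY (hf.det_jacY_ne_zero hz),
    Fin.sum_univ_two] at key hξX hξY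
  rw [hf.curvCubic_eq hz, hf.curvCubic_eq hz, hf.fderiv_hess_comm hz 0 (frameY f z ξ),
    hf.fderiv_hess_comm hz 1 (frameY f z ξ)]
  simp only [Fin.sum_univ_two]
  linear_combination -key - ξ 1 * (κ * hξX 0 - μ * hξY 0) + ξ 0 * (κ * hξX 1 - μ * hξY 1)

end IsTransversalProduct

lemma curvSymIsTrace_of_mul_curvCubic_eq
    (h : ∀ ξ : V2, ξ ≠ 0 → ξ 1 * curvCubic f 0 z ξ = ξ 0 * curvCubic f 1 z ξ) :
    CurvSymIsTrace f z := by
  -- A binary quartic form vanishing in five directions is zero.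
  have h₁₀ := h ![1, 0] (by simp)
  have h₀₁ := h ![0, 1] (by simp)
  have h₁₁ := h ![1, 1] (by simp)
  have h₁₂ := h ![1, -1] (by simp)
  have h₂₁ := h ![2, 1] (by simp)
  simp only [curvCubic, Fin.sum_univ_two, Matrix.cons_val_zero, Matrix.cons_val_one] at *
  -- The factors `3 / 2` solve `b¹₍₁₁₂₎ = 2 / 3 * b₁₂`.
  refine ⟨!![curvSym f 0 0 0 0 z, 3 / 2 * curvSym f 0 0 0 1 z;
    3 / 2 * curvSym f 0 0 0 1 z, curvSym f 1 1 1 1 z], fun i j k l => ?_⟩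
  fin_cases i <;> fin_cases j <;> fin_cases k <;> fin_cases l <;>
    simp [curvSym, sym3] <;> linarith

theorem IsWebOn.curvSymIsTrace (hf : IsWebOn f U) (hgeo : IsTransversallyGeodesicOn f U)
    (hz : z ∈ U) : CurvSymIsTrace f z := by
  refine curvSymIsTrace_of_mul_curvCubic_eq fun ξ hξ => ?_
  obtain ⟨O, φ, h0, rfl, hU, hφ, hplane, htrans⟩ := hgeo z hz ξ hξ
  obtain ⟨X, Y, h⟩ := IsTransversalSurface.exists_isTransversalProduct ⟨hφ, htrans⟩ hf hU h0 hξ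
    hplane
  exact h.mul_curvCubic_eq hf hz hξ

end

/-! ### The tensors of the example -/

section

variable {z : M4}

/-- The coordinate form `dxⁱ`. -/
noncomputable def dX (i : Fin 2) : M4 →L[ℝ] ℝ :=
  (ContinuousLinearMap.proj i).comp (ContinuousLinearMap.fst ℝ V2 V2)

/-- The coordinate form `dyⁱ`. -/
noncomputable def dY (i : Fin 2) : M4 →L[ℝ] ℝ :=
  (ContinuousLinearMap.proj i).comp (ContinuousLinearMap.snd ℝ V2 V2)

@[simp] lemma dX_apply (i : Fin 2) (v : M4) : dX i v = v.1 i := rfl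

@[simp] lemma dY_apply (i : Fin 2) (v : M4) : dY i v = v.2 i := rfl

/-- The bilinear form polarizing the quadratic form `z ↦ 2 a(z) b(z)`. It is the second derivative
of `z ↦ a(z) b(z)`, so second derivatives of products of linear forms are constant. -/
noncomputable def symProd {E : Type*} [NormedAddCommGroup E] [NormedSpace ℝ E]
    (a b : E →L[ℝ] ℝ) : E →L[ℝ] E →L[ℝ] ℝ :=
  a.smulRight b + b.smulRight a

@[simp] lemma symProd_apply {E : Type*} [NormedAddCommGroup E] [NormedSpace ℝ E]
    (a b : E →L[ℝ] ℝ) (v w : E) : symProd a b v w = a v * b w + b v * a w := rfl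

lemma hasFDerivAt_mul_symProd {E : Type*} [NormedAddCommGroup E] [NormedSpace ℝ E]
    (a b : E →L[ℝ] ℝ) (v : E) : HasFDerivAt (fun w => a w * b w) (symProd a b v) v :=
  a.hasFDerivAt.mul b.hasFDerivAt

lemma hasFDerivAt_dlt (z : M4) :
    HasFDerivAt dlt (symProd (dX 0) (dY 1) z + symProd (dX 1) (dY 0) z) z :=
  (hasFDerivAt_mul_symProd (dX 0) (dY 1) z).add (hasFDerivAt_mul_symProd (dX 1) (dY 0) z)

lemma hasFDerivAt_rho (z : M4) :
    HasFDerivAt rho (symProd (dX 0) (dX 1) z + symProd (dY 0) (dY 1) z) z :=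
  (hasFDerivAt_mul_symProd (dX 0) (dX 1) z).add (hasFDerivAt_mul_symProd (dY 0) (dY 1) z)

lemma hasFDerivAt_sigm (z : M4) :
    HasFDerivAt sigm (symProd (dX 0) (dY 1) z - symProd (dX 1) (dY 0) z) z :=
  (hasFDerivAt_mul_symProd (dX 0) (dY 1) z).sub (hasFDerivAt_mul_symProd (dX 1) (dY 0) z)

/-- The constant second derivative of `exWeb`. -/
noncomputable def exHess : Fin 2 → M4 →L[ℝ] M4 →L[ℝ] ℝ :=
  ![symProd (dX 0 + dY 0) (dX 1 - dY 1), symProd (dX 0 - dY 0) (dX 1 + dY 1)]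

lemma fderiv_exWeb (i : Fin 2) : fderiv ℝ (fun w => exWeb w i) = exHess i := by
  ext1 z
  fin_cases i
  · exact (hasFDerivAt_mul_symProd (dX 0 + dY 0) (dX 1 - dY 1) z).fderiv
  · exact (hasFDerivAt_mul_symProd (dX 0 - dY 0) (dX 1 + dY 1) z).fderiv

lemma hess_exWeb (i : Fin 2) : hess exWeb i = fun _ => exHess i := by
  ext1 z
  rw [hess, fderiv_exWeb, ContinuousLinearMap.fderiv]

lemma exHess_one_apply_inl_inr (v w : V2) : exHess 1 (v, 0) (0, w) = -exHess 0 (v, 0) (0, w) := by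
  simp [exHess, add_comm]

lemma gamSumVanishes_exWeb (z : M4) : GamSumVanishes exWeb z := fun j k => by
  simp only [Gam_eq, hess_exWeb, frame1, frame2, exHess_one_apply_inl_inr]

lemma jacX_exWeb (z : M4) :
    jacX exWeb z = !![z.1 1 - z.2 1, z.1 0 + z.2 0; z.1 1 + z.2 1, z.1 0 - z.2 0] := by
  ext i j
  fin_cases i <;> fin_cases j <;> simp [jacX, fderiv_exWeb, exHess]

lemma jacY_exWeb (z : M4) :
    jacY exWeb z = !![z.1 1 - z.2 1, -(z.1 0 + z.2 0); -(z.1 1 + z.2 1), z.1 0 - z.2 0] := by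
  ext i j
  fin_cases i <;> fin_cases j <;> simp [jacY, fderiv_exWeb, exHess]

lemma det_jacX_exWeb (z : M4) : (jacX exWeb z).det = -2 * dlt z := by
  rw [jacX_exWeb, Matrix.det_fin_two_of, dlt]
  ring

lemma det_jacY_exWeb (z : M4) : (jacY exWeb z).det = -2 * dlt z := by
  rw [jacY_exWeb, Matrix.det_fin_two_of, dlt]
  ring

lemma isOpen_dom : IsOpen dom :=
  isOpen_ne_fun (by unfold dlt; fun_prop) continuous_const

lemma isOpen_domA : IsOpen domA :=
  isOpen_dom.inter (isOpen_ne_fun (by unfold rho; fun_prop) continuous_const)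

lemma contDiff_exWeb : ContDiff ℝ ∞ exWeb := by
  rw [contDiff_pi]
  intro i
  fin_cases i <;> simp only [exWeb, Fin.zero_eta, Fin.mk_one, Matrix.cons_val_zero,
    Matrix.cons_val_one] <;> fun_prop

lemma isWebOn_exWeb : IsWebOn exWeb dom := by
  refine ⟨isOpen_dom, contDiff_exWeb.contDiffOn, fun z (hz : dlt z ≠ 0) => ?_⟩
  rw [det_jacX_exWeb, det_jacY_exWeb]
  simp [hz]

lemma parallelCond_exWeb (z : M4) : ParallelCond exWeb z :=
  GamSumVanishes.parallelCond (.of_forall gamSumVanishes_exWeb)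

lemma frame1_exWeb (j : Fin 2) (z : M4) : frame1 exWeb j z =
    (2 * dlt z)⁻¹ • (![![-(z.1 0 - z.2 0), z.1 1 + z.2 1], ![z.1 0 + z.2 0, -(z.1 1 - z.2 1)]] j,
      0) := by
  rw [frame1, Matrix.inv_def, det_jacX_exWeb, jacX_exWeb, Matrix.adjugate_fin_two_of]
  ext l
  · fin_cases j <;> fin_cases l <;> simp <;> ring
  · simp

lemma frame2_exWeb (j : Fin 2) (z : M4) : frame2 exWeb j z =
    (2 * dlt z)⁻¹ • (0,
      ![![-(z.1 0 - z.2 0), -(z.1 1 + z.2 1)], ![-(z.1 0 + z.2 0), -(z.1 1 - z.2 1)]] j) := by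
  rw [frame2, Matrix.inv_def, det_jacY_exWeb, jacY_exWeb, Matrix.adjugate_fin_two_of]
  ext l
  · simp
  · fin_cases j <;> fin_cases l <;> simp <;> ring

lemma Gam_exWeb_zero (j k : Fin 2) (z : M4) :
    Gam exWeb 0 j k z = !![exWeb z 1, rho z; -rho z, -exWeb z 0] j k / (2 * dlt z ^ 2) := by
  fin_cases j <;> fin_cases k <;>
    simp [Gam_eq, hess_exWeb, exHess, frame1_exWeb, frame2_exWeb, exWeb, rho] <;> ring

lemma hess_exWeb_frame1 (m j k : Fin 2) (z : M4) :
    hess exWeb m z (frame1 exWeb j z) (frame1 exWeb k z) =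
      -!![exWeb z 1, -rho z; -rho z, exWeb z 0] j k / (2 * dlt z ^ 2) := by
  fin_cases m <;> fin_cases j <;> fin_cases k <;>
    simp [hess_exWeb, exHess, frame1_exWeb, exWeb, rho] <;> ring

lemma hess_exWeb_frame2 (m j k : Fin 2) (z : M4) :
    hess exWeb m z (frame2 exWeb j z) (frame2 exWeb k z) =
      -!![exWeb z 1, rho z; rho z, exWeb z 0] j k / (2 * dlt z ^ 2) := by
  fin_cases m <;> fin_cases j <;> fin_cases k <;>
    simp [hess_exWeb, exHess, frame2_exWeb, exWeb, rho] <;> ring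

lemma covec_exWeb (j : Fin 2) (z : M4) : covec exWeb j z = -rho z / dlt z ^ 2 := by
  rw [(gamSumVanishes_exWeb z).covec_eq, Gam_exWeb_zero, Gam_exWeb_zero]
  simp
  ring

/-- The field `x¹∂₁ - x²∂₂` of the plane `x`, which spans `Δ` together with `hypY`. -/
def hypX (z : M4) : M4 := (![z.1 0, -z.1 1], 0)

/-- The field `y¹∂₁ - y²∂₂` of the plane `y`. -/
def hypY (z : M4) : M4 := (0, ![z.2 0, -z.2 1])

lemma frame1_exWeb_one_sub_zero (z : M4) :
    frame1 exWeb 1 z - frame1 exWeb 0 z = (dlt z)⁻¹ • hypX z := by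
  ext l
  · fin_cases l <;> simp [frame1_exWeb, hypX] <;> ring
  · simp [frame1, hypX]

lemma frame2_exWeb_one_sub_zero (z : M4) :
    frame2 exWeb 1 z - frame2 exWeb 0 z = -((dlt z)⁻¹ • hypY z) := by
  ext l
  · simp [frame2, hypY]
  · fin_cases l <;> simp [frame2_exWeb, hypY] <;> ring

lemma fderiv_dlt_hypX (z : M4) : fderiv ℝ dlt z (hypX z) = sigm z := by
  simp [(hasFDerivAt_dlt z).fderiv, hypX, sigm]
  ring

lemma fderiv_dlt_hypY (z : M4) : fderiv ℝ dlt z (hypY z) = -sigm z := by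
  simp [(hasFDerivAt_dlt z).fderiv, hypY, sigm]
  ring

lemma fderiv_rho_hypX (z : M4) : fderiv ℝ rho z (hypX z) = 0 := by
  simp [(hasFDerivAt_rho z).fderiv, hypX]
  ring

lemma fderiv_rho_hypY (z : M4) : fderiv ℝ rho z (hypY z) = 0 := by
  simp [(hasFDerivAt_rho z).fderiv, hypY]
  ring

lemma fderiv_covec_exWeb (hz : z ∈ dom) (j : Fin 2) (v : M4) : fderiv ℝ (covec exWeb j) z v =
    (2 * rho z * fderiv ℝ dlt z v - dlt z * fderiv ℝ rho z v) / dlt z ^ 3 := by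
  have hδ : dlt z ≠ 0 := hz
  have hcovec : covec exWeb j = fun w => -rho w * (dlt w ^ 2)⁻¹ := funext (covec_exWeb j)
  have hρ := (hasFDerivAt_rho z).differentiableAt.hasFDerivAt.fun_neg
  have hinv := ((hasDerivAt_pow 2 (dlt z)).fun_inv (pow_ne_zero 2 hδ)).comp_hasFDerivAt z
    (hasFDerivAt_dlt z).differentiableAt.hasFDerivAt
  have h : HasFDerivAt (fun w => -rho w * (dlt w ^ 2)⁻¹) _ z := hρ.mul hinv
  rw [hcovec, h.fderiv]
  simp
  field_simp
  ring

lemma covec_exWeb_one : covec exWeb 1 = covec exWeb 0 := by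
  ext1 z
  rw [covec_exWeb, covec_exWeb]

lemma pInv_exWeb (hz : z ∈ dom) : pInv exWeb z = rho z * sigm z / dlt z ^ 4 := by
  have hδ : dlt z ≠ 0 := hz
  simp only [pInv, pT, (gamSumVanishes_exWeb z).nablaCovec_eq, covec_exWeb_one]
  rw [← map_sub, frame1_exWeb_one_sub_zero, map_smul, fderiv_covec_exWeb hz, fderiv_dlt_hypX,
    fderiv_rho_hypX, smul_eq_mul]
  field_simp
  ring

lemma qInv_exWeb (hz : z ∈ dom) : qInv exWeb z = rho z * sigm z / dlt z ^ 4 := by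
  have hδ : dlt z ≠ 0 := hz
  simp only [qInv, qT, (gamSumVanishes_exWeb z).nablaCovec_eq, covec_exWeb_one]
  rw [← map_sub, frame2_exWeb_one_sub_zero, map_neg, map_smul, fderiv_covec_exWeb hz,
    fderiv_dlt_hypY, fderiv_rho_hypY, smul_eq_mul]
  field_simp
  ring

lemma curv_exWeb_zero (hz : z ∈ dom) (j k l : Fin 2) :
    curv exWeb 0 j k l z = ∑ m,
      ((!![exWeb z 1, -rho z; -rho z, exWeb z 0] k j / (2 * dlt z ^ 2) - Gam exWeb m k j z)
          * Gam exWeb 0 m l z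
        - (!![exWeb z 1, rho z; rho z, exWeb z 0] l j / (2 * dlt z ^ 2) - Gam exWeb m j l z)
          * Gam exWeb 0 k m z) := by
  simp only [isWebOn_exWeb.curv_eq hz, hess_exWeb_frame1, hess_exWeb_frame2,
    show fderiv ℝ (hess exWeb 0) z = 0 by rw [hess_exWeb, fderiv_fun_const]; rfl,
    ← neg_eq_iff_eq_neg.2 (Gam_eq exWeb 0 _ _ z), zero_apply, neg_zero, zero_add]
  exact Finset.sum_congr rfl fun m _ => by ring

lemma hexagonalCond_exWeb (hz : z ∈ dom) : HexagonalCond exWeb z := by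
  have h₀ : -curv exWeb 0 0 0 0 z + 3 * (curvSym exWeb 0 0 0 1 z - curvSym exWeb 0 0 1 1 z)
      + curv exWeb 0 1 1 1 z = 0 := by
    simp [curvSym, sym3, curv_exWeb_zero hz, Gam_exWeb_zero, gamSumVanishes_exWeb z _ _]
    ring
  have hcurv := GamSumVanishes.curv_one (.of_forall gamSumVanishes_exWeb : ∀ᶠ w in 𝓝 z, _)
  intro i
  fin_cases i
  · exact h₀
  · simp only [curvSym, sym3, Fin.mk_one, hcurv] at h₀ ⊢
    linarith

lemma curv_exWeb_zero_zero (hz : z ∈ dom) :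
    curv exWeb 0 0 0 0 z = -rho z * exWeb z 1 / dlt z ^ 4 := by
  simp [curv_exWeb_zero hz, Gam_exWeb_zero, gamSumVanishes_exWeb z _ _]
  ring

lemma curv_exWeb_zero_one (hz : z ∈ dom) :
    curv exWeb 0 1 1 1 z = rho z * exWeb z 0 / dlt z ^ 4 := by
  simp [curv_exWeb_zero hz, Gam_exWeb_zero, gamSumVanishes_exWeb z _ _]
  ring

lemma CurvSymIsTrace.curv_eq_zero {f : M4 → V2} (h : CurvSymIsTrace f z) {i j : Fin 2}
    (hij : i ≠ j) : curv f i j j j z = 0 := by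
  obtain ⟨c, hc⟩ := h
  have hijjj := hc i j j j
  simp only [curvSym, sym3, if_neg hij] at hijjj
  linarith

lemma exWeb_zero_sub_one (z : M4) : exWeb z 0 - exWeb z 1 = -2 * sigm z := by
  simp only [exWeb, sigm, Matrix.cons_val_zero, Matrix.cons_val_one]
  ring

lemma not_curvSymIsTrace_exWeb (hz : z ∈ domN) : ¬ CurvSymIsTrace exWeb z := by
  obtain ⟨hδ, hρ, hσ⟩ := hz
  intro h
  have h₁ := h.curv_eq_zero (i := 1) (j := 0) (by decide)
  have h₀ := h.curv_eq_zero (i := 0) (j := 1) (by decide)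
  rw [GamSumVanishes.curv_one (.of_forall gamSumVanishes_exWeb), curv_exWeb_zero_zero hδ] at h₁
  rw [curv_exWeb_zero_one hδ] at h₀
  have hf₁ : exWeb z 1 = 0 := by simpa [hδ, hρ] using h₁
  have hf₀ : exWeb z 0 = 0 := by simpa [hδ, hρ] using h₀
  have hσ₀ := exWeb_zero_sub_one z
  exact hσ (by linarith)

end

/-! ### The integral surfaces of the transversal distribution -/

section

variable {z w : M4} {O : Set (ℝ × ℝ)} {φ : ℝ × ℝ → M4}

lemma covec_exWeb_ne_zero (hz : z ∈ domA) : covec exWeb 0 z ≠ 0 := by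
  rw [covec_exWeb]
  exact div_ne_zero (neg_ne_zero.2 hz.2) (pow_ne_zero 2 hz.1)

/-- The first integral `x¹x²` of `Δ`. -/
def prodX (z : M4) : ℝ := z.1 0 * z.1 1

/-- The first integral `y¹y²` of `Δ`. -/
def prodY (z : M4) : ℝ := z.2 0 * z.2 1

lemma hasFDerivAt_prodX (z : M4) : HasFDerivAt prodX (symProd (dX 0) (dX 1) z) z :=
  hasFDerivAt_mul_symProd (dX 0) (dX 1) z

lemma hasFDerivAt_prodY (z : M4) : HasFDerivAt prodY (symProd (dY 0) (dY 1) z) z :=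
  hasFDerivAt_mul_symProd (dY 0) (dY 1) z

lemma mem_aDist_exWeb_iff (hz : z ∈ domA) (v : M4) :
    v ∈ aDist exWeb z ↔ fderiv ℝ prodX z v = 0 ∧ fderiv ℝ prodY z v = 0 := by
  have h₁ : omega1 exWeb 0 z v + omega1 exWeb 1 z v = 2 * fderiv ℝ prodX z v := by
    simp [omega1_apply, fderiv_exWeb, exHess, (hasFDerivAt_prodX z).fderiv]
    ring
  have h₂ : omega2 exWeb 0 z v + omega2 exWeb 1 z v = -2 * fderiv ℝ prodY z v := by
    simp [omega2_apply, fderiv_exWeb, exHess, (hasFDerivAt_prodY z).fderiv]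
    ring
  simp [(gamSumVanishes_exWeb z).mem_aDist_iff (covec_exWeb_ne_zero hz), h₁, h₂]

lemma exists_eq_smul_of_mul_add_mul_eq_zero {K : Type*} [Field K] {u v : Fin 2 → K}
    (hu : u ≠ 0) (h : u 0 * v 1 + u 1 * v 0 = 0) : ∃ t : K, v = t • ![u 0, -u 1] := by
  refine exists_eq_smul_of_mul_eq (fun h₀ => hu (funext (Fin.forall_fin_two.2 ⟨?_, ?_⟩))) ?_
  · simpa using congrFun h₀ 0
  · simpa using congrFun h₀ 1
  · simp only [Matrix.cons_val_zero, Matrix.cons_val_one, Matrix.cons_val_fin_one]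
    linear_combination -h

lemma fst_ne_zero_of_mem_dom (hz : z ∈ dom) : z.1 ≠ 0 := fun h => hz (by simp [dlt, h])

lemma snd_ne_zero_of_mem_dom (hz : z ∈ dom) : z.2 ≠ 0 := fun h => hz (by simp [dlt, h])

lemma mem_aDist_exWeb_iff_exists (hz : z ∈ domA) (v : M4) :
    v ∈ aDist exWeb z ↔ ∃ s t : ℝ, v = s • hypX z + t • hypY z := by
  rw [mem_aDist_exWeb_iff hz, (hasFDerivAt_prodX z).fderiv, (hasFDerivAt_prodY z).fderiv]
  constructor
  · rintro ⟨hX, hY⟩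
    obtain ⟨s, hs⟩ := exists_eq_smul_of_mul_add_mul_eq_zero (fst_ne_zero_of_mem_dom hz.1) hX
    obtain ⟨t, ht⟩ := exists_eq_smul_of_mul_add_mul_eq_zero (snd_ne_zero_of_mem_dom hz.1) hY
    exact ⟨s, t, Prod.ext (by simp [hypX, hypY, hs]) (by simp [hypX, hypY, ht])⟩
  · rintro ⟨s, t, rfl⟩
    constructor <;> simp [hypX, hypY] <;> ring

lemma smul_hypX_add_smul_hypY_eq_zero_iff (hz : z ∈ dom) {s t : ℝ} :
    s • hypX z + t • hypY z = 0 ↔ s = 0 ∧ t = 0 := by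
  have hX : ¬ (z.1 0 = 0 ∧ z.1 1 = 0) := fun h => hz (by simp [dlt, h])
  have hY : ¬ (z.2 0 = 0 ∧ z.2 1 = 0) := fun h => hz (by simp [dlt, h])
  simp only [hypX, hypY, Prod.ext_iff, funext_iff, Fin.forall_fin_two]
  simp
  tauto

/-- The integral surface `(x¹eˢ, x²e⁻ˢ, y¹eᵗ, y²e⁻ᵗ)` of `Δ` through the point `(x, y)`. -/
noncomputable def hypSurface (z : M4) (s : ℝ × ℝ) : M4 :=
  (![z.1 0 * Real.exp s.1, z.1 1 * Real.exp (-s.1)],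
    ![z.2 0 * Real.exp s.2, z.2 1 * Real.exp (-s.2)])

lemma hypSurface_zero (z : M4) : hypSurface z 0 = z := by
  ext l <;> fin_cases l <;> simp [hypSurface]

lemma contDiff_hypSurface (z : M4) : ContDiff ℝ ∞ (hypSurface z) := by
  refine ContDiff.prodMk ?_ ?_ <;> rw [contDiff_pi, Fin.forall_fin_two] <;> constructor <;>
    simp only [Matrix.cons_val_zero, Matrix.cons_val_one, Matrix.cons_val_fin_one] <;> fun_prop

lemma fderiv_hypSurface (z : M4) (s v : ℝ × ℝ) : fderiv ℝ (hypSurface z) s v =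
    v.1 • hypX (hypSurface z s) + v.2 • hypY (hypSurface z s) := by
  have hexp₁ : HasFDerivAt (fun s : ℝ × ℝ => Real.exp s.1) _ s := hasFDerivAt_fst.exp
  have hexp₂ : HasFDerivAt (fun s : ℝ × ℝ => Real.exp (-s.1)) _ s := hasFDerivAt_fst.fun_neg.exp
  have hexp₃ : HasFDerivAt (fun s : ℝ × ℝ => Real.exp s.2) _ s := hasFDerivAt_snd.exp
  have hexp₄ : HasFDerivAt (fun s : ℝ × ℝ => Real.exp (-s.2)) _ s := hasFDerivAt_snd.fun_neg.exp
  have hfst : HasFDerivAt (fun s => (hypSurface z s).1)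
      ((ContinuousLinearMap.fst ℝ ℝ ℝ).smulRight (hypX (hypSurface z s)).1) s := by
    refine hasFDerivAt_pi'.2 (Fin.forall_fin_two.2 ⟨?_, ?_⟩)
    · exact (hexp₁.const_mul _).congr_fderiv (by ext <;> simp [hypX, hypSurface])
    · exact (hexp₂.const_mul _).congr_fderiv (by ext <;> simp [hypX, hypSurface])
  have hsnd : HasFDerivAt (fun s => (hypSurface z s).2)
      ((ContinuousLinearMap.snd ℝ ℝ ℝ).smulRight (hypY (hypSurface z s)).2) s := by
    refine hasFDerivAt_pi'.2 (Fin.forall_fin_two.2 ⟨?_, ?_⟩)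
    · exact (hexp₃.const_mul _).congr_fderiv (by ext <;> simp [hypY, hypSurface])
    · exact (hexp₄.const_mul _).congr_fderiv (by ext <;> simp [hypY, hypSurface])
  have h : HasFDerivAt (hypSurface z) _ s := hfst.prodMk hsnd
  rw [h.fderiv]
  simp [hypX, hypY]

lemma isIntegrableOn_aDist_exWeb : IsIntegrableOn (aDist exWeb) domA := by
  intro z hz
  refine ⟨hypSurface z ⁻¹' domA, hypSurface z, by rwa [Set.mem_preimage, hypSurface_zero],
    hypSurface_zero z, Set.mapsTo_preimage _ _,
    ⟨isOpen_domA.preimage (contDiff_hypSurface z).continuous, (contDiff_hypSurface z).contDiffOn,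
      fun s hs => ?_⟩, fun s hs => ?_⟩
  · rw [injective_iff_map_eq_zero]
    intro v hv
    rw [fderiv_hypSurface, smul_hypX_add_smul_hypY_eq_zero_iff hs.1] at hv
    exact Prod.ext hv.1 hv.2
  · ext v
    rw [mem_aDist_exWeb_iff_exists hs]
    simp [tangentPlane, fderiv_hypSurface, eq_comm]

lemma IsIntegralSurface.apply_comp_eq {D : M4 → Submodule ℝ M4} (hφ : IsIntegralSurface D O φ)
    {g : M4 → ℝ} (hg : Differentiable ℝ g) (hD : ∀ s ∈ O, ∀ v ∈ D (φ s), fderiv ℝ g (φ s) v = 0)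
    {N : Set (ℝ × ℝ)} (hN : IsOpen N) (hN' : IsPreconnected N) (hNO : N ⊆ O) {P Q : ℝ × ℝ}
    (hP : P ∈ N) (hQ : Q ∈ N) : g (φ P) = g (φ Q) := by
  have hderiv (s) (hs : s ∈ N) :
      HasFDerivAt (fun t => g (φ t)) ((fderiv ℝ g (φ s)).comp (fderiv ℝ φ s)) s :=
    (hg (φ s)).hasFDerivAt.comp s (hφ.1.hasFDerivAt (hNO hs))
  refine hN.is_const_of_fderiv_eq_zero hN'
    (fun s hs => (hderiv s hs).differentiableAt.differentiableWithinAt) (fun s hs => ?_) hP hQ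
  refine ContinuousLinearMap.ext fun v => ?_
  rw [(hderiv s hs).fderiv]
  exact hD s (hNO hs) _ (by rw [← hφ.2 s (hNO hs)]; exact ⟨v, rfl⟩)

lemma hexagonsClose_of_mul {h₁ h₂ h₃ : ℝ × ℝ → V2} {N : Set (ℝ × ℝ)} (x y : ℝ × ℝ → ℝ)
    (hx : ∀ P ∈ N, x P ≠ 0) (hy : ∀ P ∈ N, y P ≠ 0)
    (h₁x : ∀ P ∈ N, ∀ Q ∈ N, h₁ P = h₁ Q → x P = x Q)
    (h₂y : ∀ P ∈ N, ∀ Q ∈ N, h₂ P = h₂ Q ↔ y P = y Q)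
    (h₃xy : ∀ P ∈ N, ∀ Q ∈ N, h₃ P = h₃ Q → x P * y P = x Q * y Q) :
    HexagonsClose h₁ h₂ h₃ N := by
  intro P₀ m₀ P₁ m₁ P₂ m₂ P₃ m₃ P₄ m₄ P₅ m₅ P₆ m₆ e₁ e₄ e₂ e₅ e₃ e₆ e₁₂ e₂₃ e₃₄ e₄₅ e₅₆
  rw [h₂y P₆ m₆ P₁ m₁]
  have hxy₃ : x P₃ * y P₃ = x P₀ * y P₀ := h₃xy _ m₃ _ m₀ e₃
  have hxy₆ : x P₆ * y P₆ = x P₀ * y P₀ := h₃xy _ m₆ _ m₀ e₆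
  have hxy₁₂ : x P₀ * y P₁ = x P₃ * y P₀ := by
    rw [← h₁x _ m₁ _ m₀ e₁, ← (h₂y _ m₂ _ m₀).1 e₂, ← h₁x _ m₂ _ m₃ e₂₃]
    exact h₃xy _ m₁ _ m₂ e₁₂
  have hxy₄₅ : x P₀ * y P₃ = x P₆ * y P₀ := by
    rw [← h₁x _ m₄ _ m₀ e₄, ← (h₂y _ m₅ _ m₀).1 e₅, (h₂y _ m₃ _ m₄).1 e₃₄,
      ← h₁x _ m₅ _ m₆ e₅₆]
    exact h₃xy _ m₄ _ m₅ e₄₅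
  have hx₃₆ : x P₃ * x P₆ = x P₀ * x P₀ :=
    mul_right_cancel₀ (hy P₀ m₀) (by linear_combination (-x P₃) * hxy₄₅ + x P₀ * hxy₃)
  refine mul_left_cancel₀ (mul_ne_zero (hx P₀ m₀) (hx P₆ m₆)) ?_
  linear_combination x P₀ * hxy₆ - x P₆ * hxy₁₂ - y P₀ * hx₃₆

lemma dlt_sq (z : M4) : dlt z ^ 2 = sigm z ^ 2 + 4 * prodX z * prodY z := by
  simp only [dlt, sigm, prodX, prodY]
  ring

lemma mul_apply_eq_of_exWeb_eq (hf : exWeb z = exWeb w) (hX : prodX z = prodX w)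
    (hY : prodY z = prodY w) (hδ : dlt z + dlt w ≠ 0) {i j : Fin 2} (hij : i ≠ j) :
    z.1 i * z.2 j = w.1 i * w.2 j := by
  have hσ : sigm z = sigm w := by
    linarith [exWeb_zero_sub_one z, exWeb_zero_sub_one w, congrFun hf 0, congrFun hf 1]
  have hδ' : dlt z = dlt w := by
    have hsq : dlt z ^ 2 = dlt w ^ 2 := by rw [dlt_sq, dlt_sq, hσ, hX, hY]
    exact (sq_eq_sq_iff_eq_or_eq_neg.1 hsq).resolve_right fun h => hδ (by rw [h, neg_add_cancel])
  simp only [dlt, sigm] at hσ hδ'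
  fin_cases i <;> fin_cases j <;> simp at hij ⊢ <;> linarith

lemma eq_of_mul_eq_of_apply_eq {K : Type*} [Field K] {v w : Fin 2 → K}
    (hmul : v 0 * v 1 = w 0 * w 1) {j : Fin 2} (hj : v j = w j) (hw : w j ≠ 0) : v = w := by
  ext l
  fin_cases j <;> fin_cases l <;> simp_all

lemma exists_apply_ne_zero_of_mem_dom (hz : z ∈ dom) :
    ∃ i j : Fin 2, i ≠ j ∧ z.1 i ≠ 0 ∧ z.2 j ≠ 0 := by
  by_contra! h
  apply hz
  by_cases h₀ : z.1 0 = 0 <;> by_cases h₁ : z.1 1 = 0 <;> simp_all [dlt]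

lemma IsIntegralSurface.prod_eq (hφ : IsIntegralSurface (aDist exWeb) O φ)
    (hm : Set.MapsTo φ O domA) {N : Set (ℝ × ℝ)} (hN : IsOpen N) (hN' : IsPreconnected N)
    (hNO : N ⊆ O) {P Q : ℝ × ℝ} (hP : P ∈ N) (hQ : Q ∈ N) :
    prodX (φ P) = prodX (φ Q) ∧ prodY (φ P) = prodY (φ Q) :=
  ⟨hφ.apply_comp_eq (fun z => (hasFDerivAt_prodX z).differentiableAt)
      (fun _ hs v hv => ((mem_aDist_exWeb_iff (hm hs) v).1 hv).1) hN hN' hNO hP hQ,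
    hφ.apply_comp_eq (fun z => (hasFDerivAt_prodY z).differentiableAt)
      (fun _ hs v hv => ((mem_aDist_exWeb_iff (hm hs) v).1 hv).2) hN hN' hNO hP hQ⟩

lemma IsIntegralSurface.exists_hexagonsClose (hφ : IsIntegralSurface (aDist exWeb) O φ)
    (hm : Set.MapsTo φ O domA) {s : ℝ × ℝ} (hs : s ∈ O) :
    ∃ N ∈ 𝓝 s, N ⊆ O ∧
      HexagonsClose (fun t => (φ t).1) (fun t => (φ t).2) (fun t => exWeb (φ t)) N := by
  have hδ : dlt (φ s) ≠ 0 := (hm hs).1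
  obtain ⟨i, j, hij, hi, hj⟩ := exists_apply_ne_zero_of_mem_dom hδ
  have hcont : ContinuousAt φ s := (hφ.1.hasFDerivAt hs).continuousAt
  have hδcont : ContinuousAt (fun t => dlt (φ s) * dlt (φ t)) s := by
    unfold dlt
    fun_prop
  have hicont : ContinuousAt (fun t => (φ t).1 i) s := by fun_prop
  have hjcont : ContinuousAt (fun t => (φ t).2 j) s := by fun_prop
  have hev : ∀ᶠ t in 𝓝 s, t ∈ O ∧ 0 < dlt (φ s) * dlt (φ t) ∧ (φ t).1 i ≠ 0 ∧ (φ t).2 j ≠ 0 :=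
    (hφ.1.1.eventually_mem hs).and <| (hδcont.eventually_const_lt (mul_self_pos.2 hδ)).and <|
      (hicont.eventually_ne hi).and (hjcont.eventually_ne hj)
  obtain ⟨ε, hε, hN⟩ := Metric.eventually_nhds_iff_ball.1 hev
  have hprod {P Q} := hφ.prod_eq hm Metric.isOpen_ball (convex_ball s ε).isPreconnected
    (fun t ht => (hN t ht).1) (P := P) (Q := Q)
  have hδ_add {P Q} (hP : P ∈ Metric.ball s ε) (hQ : Q ∈ Metric.ball s ε) :
      dlt (φ P) + dlt (φ Q) ≠ 0 :=
    right_ne_zero_of_mul (a := dlt (φ s)) (by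
      rw [mul_add]
      exact (add_pos (hN P hP).2.1 (hN Q hQ).2.1).ne')
  refine ⟨Metric.ball s ε, Metric.ball_mem_nhds s hε, fun t ht => (hN t ht).1,
    hexagonsClose_of_mul (fun t => (φ t).1 i) (fun t => (φ t).2 j) (fun t ht => (hN t ht).2.2.1)
      (fun t ht => (hN t ht).2.2.2) (fun P _ Q _ h => congrFun h i)
      (fun P hP Q hQ => ⟨fun h => congrFun h j, fun h => ?_⟩) fun P hP Q hQ h => ?_⟩
  · exact eq_of_mul_eq_of_apply_eq (hprod hP hQ).2 h (hN Q hQ).2.2.2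
  · exact mul_apply_eq_of_exWeb_eq h (hprod hP hQ).1 (hprod hP hQ).2 (hδ_add hP hQ) hij

theorem IsIntegralSurface.cutsHexagonalWeb (hφ : IsIntegralSurface (aDist exWeb) O φ)
    (hm : Set.MapsTo φ O domA) : CutsHexagonalWeb exWeb O φ := by
  have htrans : IsTransversalSurface exWeb O φ := ⟨hφ.1, fun s hs => ⟨![1, -1], by simp, by
    rw [hφ.2 s hs, (gamSumVanishes_exWeb _).aDist_eq_transPlane (covec_exWeb_ne_zero (hm hs))]⟩⟩
  exact ⟨htrans.isPlanarWeb isWebOn_exWeb fun s hs => (hm hs).1,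
    fun s hs => hφ.exists_hexagonsClose hm hs⟩

lemma frequently_ne_zero_of_fderiv_ne_zero {E : Type*} [NormedAddCommGroup E] [NormedSpace ℝ E]
    {g : E → ℝ} {a : E} (h : fderiv ℝ g a ≠ 0) : ∃ᶠ b in 𝓝 a, g b ≠ 0 := by
  intro hzero
  have hg : g =ᶠ[𝓝 a] fun _ => 0 := hzero.mono fun _ => not_not.1
  exact h (by rw [hg.fderiv_eq, fderiv_fun_const, Pi.zero_apply])

lemma fderiv_rho_ne_zero (hz : z ∈ dom) : fderiv ℝ rho z ≠ 0 := fun h => hz <| by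
  have hδ := congrArg (fun L => L (z.2, 0)) h
  simpa [(hasFDerivAt_rho z).fderiv, dlt] using hδ

lemma fderiv_sigm_ne_zero (hz : z ∈ dom) : fderiv ℝ sigm z ≠ 0 := fun h => hz <| by
  have hδ := congrArg (fun L => L (hypX z)) h
  simp [(hasFDerivAt_sigm z).fderiv, hypX] at hδ
  rw [dlt]
  linarith

lemma exists_mem_domN {U : Set M4} (hU : IsOpen U) (hne : U.Nonempty) (hUd : U ⊆ dom) :
    ∃ z ∈ U, z ∈ domN := by
  obtain ⟨z, hz⟩ := hne
  obtain ⟨w, hρw, hw⟩ := ((frequently_ne_zero_of_fderiv_ne_zero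
    (fderiv_rho_ne_zero (hUd hz))).and_eventually (hU.mem_nhds hz)).exists
  have hρ : ∀ᶠ v in 𝓝 w, rho v ≠ 0 :=
    (hasFDerivAt_rho w).continuousAt.eventually_ne hρw
  obtain ⟨v, hσv, hv, hρv⟩ := ((frequently_ne_zero_of_fderiv_ne_zero
    (fderiv_sigm_ne_zero (hUd hw))).and_eventually ((hU.eventually_mem hw).and hρ)).exists
  exact ⟨v, hv, hUd hv, hρv, hσv⟩

theorem not_isTransversallyGeodesicOn_exWeb {U : Set M4} (hU : IsOpen U) (hne : U.Nonempty)
    (hUd : U ⊆ dom) : ¬ IsTransversallyGeodesicOn exWeb U := by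
  intro hgeo
  obtain ⟨z, hz, hzN⟩ := exists_mem_domN hU hne hUd
  exact not_curvSymIsTrace_exWeb hzN ((isWebOn_exWeb.mono hU hUd).curvSymIsTrace hgeo hz)

end

end ThreeWeb

theorem mainTheorem7 :
    -- the equations define a web on the domain
    IsWebOn exWeb dom ∧
    -- the covector `a`, and the invariants `p`, `q`
    (∀ z ∈ dom, covec exWeb 0 z = covec exWeb 1 z ∧ covec exWeb 0 z = -rho z / dlt z ^ 2) ∧
    (∀ z ∈ dom, pInv exWeb z = qInv exWeb z ∧ pInv exWeb z = rho z * sigm z / dlt z ^ 4) ∧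
    (∀ z ∈ domN, pInv exWeb z = qInv exWeb z ∧ pInv exWeb z ≠ 0) ∧
    -- the tensor conditions
    (∀ z ∈ dom, EqualCovecCond exWeb z ∧ ParallelCond exWeb z ∧ IntegrabilityCond exWeb z ∧
      HexagonalCond exWeb z) ∧
    -- the transversal distribution is `ω¹ + ω² = 0`, and it is integrable
    (∀ z ∈ domA, ∀ v : M4, v ∈ aDist exWeb z ↔
      omega1 exWeb 0 z v + omega1 exWeb 1 z v = 0 ∧
      omega2 exWeb 0 z v + omega2 exWeb 1 z v = 0) ∧
    IsIntegrableOn (aDist exWeb) domA ∧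
    -- its integral surfaces are geodesically parallel in all connections of the bundle
    (∀ P Q : M4 → ℝ, IsGeodesicallyParallelOn exWeb P Q (aDist exWeb) domA) ∧
    -- its integral surfaces carry hexagonal two-dimensional webs
    (∀ (O : Set (ℝ × ℝ)) (φ : ℝ × ℝ → M4), Set.MapsTo φ O domA →
      IsIntegralSurface (aDist exWeb) O φ → CutsHexagonalWeb exWeb O φ) ∧
    -- the web is not transversally geodesic
    (∀ z ∈ domN, ¬ CurvSymIsTrace exWeb z) ∧
    (∀ U : Set M4, IsOpen U → U.Nonempty → U ⊆ dom → ¬ IsTransversallyGeodesicOn exWeb U) := by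
  refine ⟨isWebOn_exWeb,
    fun z _ => ⟨(gamSumVanishes_exWeb z).equalCovecCond.1, covec_exWeb 0 z⟩,
    fun z hz => ⟨(pInv_exWeb hz).trans (qInv_exWeb hz).symm, pInv_exWeb hz⟩,
    fun z ⟨hδ, hρ, hσ⟩ => ⟨(pInv_exWeb hδ).trans (qInv_exWeb hδ).symm, ?_⟩,
    fun z hz => ⟨(gamSumVanishes_exWeb z).equalCovecCond, parallelCond_exWeb z,
      (parallelCond_exWeb z).integrabilityCond, hexagonalCond_exWeb hz⟩,
    fun z hz v => (gamSumVanishes_exWeb z).mem_aDist_iff (covec_exWeb_ne_zero hz) v,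
    isIntegrableOn_aDist_exWeb,
    (isWebOn_exWeb.mono isOpen_domA fun z hz => hz.1).isGeodesicallyParallelOn_aDist
      (fun z _ => gamSumVanishes_exWeb z) fun z hz => covec_exWeb_ne_zero hz,
    fun O φ hm hφ => hφ.cutsHexagonalWeb hm,
    fun z hz => not_curvSymIsTrace_exWeb hz,
    fun U hU hne hUd => not_isTransversallyGeodesicOn_exWeb hU hne hUd⟩
  rw [pInv_exWeb hδ]
  exact div_ne_zero (mul_ne_zero hρ hσ) (pow_ne_zero 4 hδ)
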